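/- Let $n,m\ge 1$ be integers, $d=\gcd(n,m)$, $a=n/d$, $b=m/d$. For $k\ge1$ put $\omega_k=e^{2\pi i/k}$, $Q_k=\mathrm{diag}(1,\omega_k,\dots,\omega_k^{k-1})$ and $(P_k)_{i,j}=\delta_{i,j-1}$ for $i,j\in\mathbb{Z}_k$. Let $\Pi_k$ be the subgroup of $\mathrm{GL}(k,\mathbb{C})$ generated by $Q_k$ and $P_k$. For invertible $M$ let $\mathrm{Ad}_M$ be the inner automorphism $X\mapsto MXM^{-1}$ of the group $\mathrm{GL}(k,\mathbb{C})$, where $k$ is the size of $M$, and let $\mathrm{Int}(\mathrm{GL}(k,\mathbb{C}))$ be the group of all $\mathrm{Ad}_M$ with $M\in\mathrm{GL}(k,\mathbb{C})$. Let $\mathcal{P}_k=\langle \mathrm{Ad}_{Q_k},\mathrm{Ad}_{P_k}\rangle$ and let $\mathcal{N}(\mathcal{P}_k)$ be its normalizer in $\mathrm{Int}(\mathrm{GL}(k,\mathbb{C}))$. Let $\mathcal{P}_n\otimes\mathcal{P}_m=\{\mathrm{Ad}_{A\otimes B}: A\in\Pi_n,\ B\in\Pi_m\}$, let $\mathcal{N}(\mathcal{P}_n\otimes\mathcal{P}_m)$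 be its normalizer in $\mathrm{Int}(\mathrm{GL}(nm,\mathbb{C}))$, and let $\mathcal{N}(\mathcal{P}_n)\otimes\mathcal{N}(\mathcal{P}_m)=\{\mathrm{Ad}_{A\otimes B}:\mathrm{Ad}_A\in\mathcal{N}(\mathcal{P}_n),\ \mathrm{Ad}_B\in\mathcal{N}(\mathcal{P}_m)\}$. Let $\mathcal{S}$ be the monoid (under matrix multiplication) of all matrices $A=\begin{pmatrix}A_{11}&aA_{12}\\ bA_{21}&A_{22}\end{pmatrix}\in M_4(\mathbb{Z})$ with $A_{ij}\in M_2(\mathbb{Z})$. For $A,B\in\mathcal{S}$ write $A\equiv B$ if, entrywise, $A_{11}\equiv B_{11}\pmod n$, $A_{12}\equiv B_{12}\pmod d$, $A_{21}\equiv B_{21}\pmod d$ and $A_{22}\equiv B_{22}\pmod m$; this is a congruence on $\mathcal{S}$. Put $A^*=\begin{pmatrix}A_{11}^T&aA_{21}^T\\ bA_{12}^T&A_{22}^T\end{pmatrix}$ and $[A]^*=[A^*]$ for the class $[A]$ of $A$ in $\mathcal{S}/{\equiv}$, and let $j=\left[\begin{pmatrix}J_2&0\\0&J_2\end{pmatrix}\right]$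 with $J_2=\begin{pmatrix}0&1\\-1&0\end{pmatrix}$. Define $\mathcal{G}=\mathcal{G}_{n,m,d,a,b}=\{x\in\mathcal{S}/{\equiv}\;:\;x^*jx=j\}$, with the multiplication of $\mathcal{S}/{\equiv}$. Then: (i) $\mathcal{G}$ is a finite group, and $\mathcal{N}(\mathcal{P}_n\otimes\mathcal{P}_m)/(\mathcal{P}_n\otimes\mathcal{P}_m)\cong\mathcal{G}$. (ii) The group $\mathcal{N}(\mathcal{P}_n\otimes\mathcal{P}_m)$ is generated by $\mathcal{N}(\mathcal{P}_n)\otimes\mathcal{N}(\mathcal{P}_m)$ together with $\mathrm{Ad}_R$, where $R=\mathrm{diag}(I_m,Q_m^{b},Q_m^{2b},\dots,Q_m^{(n-1)b})\in\mathrm{GL}(nm,\mathbb{C})$. -/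

import Mathlib

open scoped Kronecker

namespace FiniteHeisenberg

noncomputable section

/-! Generalized Pauli matrices. The rows and columns of an `n × n` matrix are indexed by
`ZMod n` (a set with `n` elements for `n ≥ 1`), in the order `0, 1, …, n - 1`. -/

/-- `ω_n = exp(2πi/n)`, as a nonzero complex number. -/
def omega (n : ℕ) : ℂˣ :=
  Units.mk0 (Complex.exp (2 * Real.pi * Complex.I / n)) (Complex.exp_ne_zero _)

/-- The invertible diagonal matrix with nonzero diagonal entries `u i`. -/
def diagGL {ι : Type} [Fintype ι] [DecidableEq ι] (u : ι → ℂˣ) : GL ι ℂ where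
  val := Matrix.diagonal fun i => (u i : ℂ)
  inv := Matrix.diagonal fun i => ((u i)⁻¹ : ℂˣ)
  val_inv := by simp [Matrix.diagonal_mul_diagonal]
  inv_val := by simp [Matrix.diagonal_mul_diagonal]

/-- `Q_n = diag(1, ω_n, …, ω_n^{n-1})`. -/
def pauliQ (n : ℕ) [NeZero n] : GL (ZMod n) ℂ := diagGL fun i => omega n ^ i.val

/-- `P_n`, with entries `(P_n)_{i,j} = δ_{i,j-1}`, `i, j ∈ ℤ_n`. -/
def pauliP (n : ℕ) [NeZero n] : GL (ZMod n) ℂ where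
  val := Matrix.of fun i j => if i = j - 1 then 1 else 0
  inv := Matrix.of fun i j => if j = i - 1 then 1 else 0
  val_inv := by
    ext i j
    rw [Matrix.mul_apply, Finset.sum_eq_single (i + 1)]
    · simp [Matrix.one_apply, eq_comm]
    · intro k _ hk
      have : i ≠ k - 1 := fun h => hk (by rw [h]; ring)
      simp [this]
    · simp
  inv_val := by
    ext i j
    rw [Matrix.mul_apply, Finset.sum_eq_single (i - 1)]
    · simp [Matrix.one_apply]
    · intro k _ hk
      simp [hk]
    · simp

/-- The finite Heisenberg group `Π_n`: the subgroup of `GL(n,ℂ)` generated by `Q_n` and `P_n`. -/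
def heisenberg (n : ℕ) [NeZero n] : Subgroup (GL (ZMod n) ℂ) :=
  Subgroup.closure {pauliQ n, pauliP n}

/-! Inner automorphisms. -/

/-- `Int(GL(ι,ℂ))`, the group of inner automorphisms `X ↦ M X M⁻¹` of the group `GL(ι,ℂ)`. -/
abbrev IntGL (ι : Type) [Fintype ι] [DecidableEq ι] : Subgroup (MulAut (GL ι ℂ)) :=
  (MulAut.conj : GL ι ℂ →* MulAut (GL ι ℂ)).range

/-- `Ad_M`, the inner automorphism `X ↦ M X M⁻¹`. -/
def Ad {ι : Type} [Fintype ι] [DecidableEq ι] : GL ι ℂ →* IntGL ι :=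
  (MulAut.conj : GL ι ℂ →* MulAut (GL ι ℂ)).rangeRestrict

/-- The group `𝒫_n` generated by `Ad_{Q_n}` and `Ad_{P_n}`. -/
def pauliGroup (n : ℕ) [NeZero n] : Subgroup (IntGL (ZMod n)) :=
  Subgroup.closure {Ad (pauliQ n), Ad (pauliP n)}

/-- The normalizer `𝒩(𝒫_n)` of `𝒫_n` in `Int(GL(n,ℂ))`. -/
def normPauli (n : ℕ) [NeZero n] : Subgroup (IntGL (ZMod n)) :=
  Subgroup.normalizer (pauliGroup n : Set (IntGL (ZMod n)))

/-! Tensor products. `GL(nm,ℂ)` is realised on the index set `ZMod n × ZMod m`. -/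

/-- The tensor (Kronecker) product of two invertible matrices. -/
def tensor {ι κ : Type} [Fintype ι] [DecidableEq ι] [Fintype κ] [DecidableEq κ]
    (A : GL ι ℂ) (B : GL κ ℂ) : GL (ι × κ) ℂ where
  val := (A : Matrix ι ι ℂ) ⊗ₖ (B : Matrix κ κ ℂ)
  inv := ((A⁻¹ : GL ι ℂ) : Matrix ι ι ℂ) ⊗ₖ ((B⁻¹ : GL κ ℂ) : Matrix κ κ ℂ)
  val_inv := by
    rw [← Matrix.mul_kronecker_mul, Units.mul_inv, Units.mul_inv, Matrix.one_kronecker_one]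
  inv_val := by
    rw [← Matrix.mul_kronecker_mul, Units.inv_mul, Units.inv_mul, Matrix.one_kronecker_one]

theorem tensor_mul {ι κ : Type} [Fintype ι] [DecidableEq ι] [Fintype κ] [DecidableEq κ]
    (A A' : GL ι ℂ) (B B' : GL κ ℂ) :
    tensor A B * tensor A' B' = tensor (A * A') (B * B') := by
  apply Units.ext
  exact (Matrix.mul_kronecker_mul _ _ _ _).symm

theorem tensor_one {ι κ : Type} [Fintype ι] [DecidableEq ι] [Fintype κ] [DecidableEq κ] :
    tensor (1 : GL ι ℂ) (1 : GL κ ℂ) = 1 := by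
  apply Units.ext
  exact Matrix.one_kronecker_one

theorem tensor_inv {ι κ : Type} [Fintype ι] [DecidableEq ι] [Fintype κ] [DecidableEq κ]
    (A : GL ι ℂ) (B : GL κ ℂ) : (tensor A B)⁻¹ = tensor A⁻¹ B⁻¹ := by
  apply Units.ext
  rfl

/-- The group `𝒫_n ⊗ 𝒫_m = {Ad_{A ⊗ B} | A ∈ Π_n, B ∈ Π_m}`. -/
def pauliTensor (n m : ℕ) [NeZero n] [NeZero m] : Subgroup (IntGL (ZMod n × ZMod m)) where
  carrier := {x | ∃ A ∈ heisenberg n, ∃ B ∈ heisenberg m, x = Ad (tensor A B)}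
  mul_mem' := by
    rintro _ _ ⟨A, hA, B, hB, rfl⟩ ⟨A', hA', B', hB', rfl⟩
    exact ⟨A * A', mul_mem hA hA', B * B', mul_mem hB hB', by rw [← map_mul, tensor_mul]⟩
  one_mem' := ⟨1, one_mem _, 1, one_mem _, by rw [tensor_one, map_one]⟩
  inv_mem' := by
    rintro _ ⟨A, hA, B, hB, rfl⟩
    exact ⟨A⁻¹, inv_mem hA, B⁻¹, inv_mem hB, by rw [← map_inv, tensor_inv]⟩

/-- The normalizer `𝒩(𝒫_n ⊗ 𝒫_m)` of `𝒫_n ⊗ 𝒫_m` in `Int(GL(nm,ℂ))`. -/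
abbrev normPauliTensor (n m : ℕ) [NeZero n] [NeZero m] : Subgroup (IntGL (ZMod n × ZMod m)) :=
  Subgroup.normalizer (pauliTensor n m : Set (IntGL (ZMod n × ZMod m)))

/-- The set `𝒩(𝒫_n) ⊗ 𝒩(𝒫_m) = {Ad_{A ⊗ B} | Ad_A ∈ 𝒩(𝒫_n), Ad_B ∈ 𝒩(𝒫_m)}`. -/
def normTensorNorm (n m : ℕ) [NeZero n] [NeZero m] : Set (IntGL (ZMod n × ZMod m)) :=
  {x | ∃ A : GL (ZMod n) ℂ, ∃ B : GL (ZMod m) ℂ,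
    Ad A ∈ normPauli n ∧ Ad B ∈ normPauli m ∧ x = Ad (tensor A B)}

/-- The block diagonal matrix `diag(D 0, D 1, …, D (n-1))` with invertible blocks; the block
index is the first component, as in the tensor product. -/
def blockDiagGL {ι κ : Type} [Fintype ι] [DecidableEq ι] [Fintype κ] [DecidableEq κ]
    (D : ι → GL κ ℂ) : GL (ι × κ) ℂ where
  val := Matrix.of fun p q => if p.1 = q.1 then (D p.1 : Matrix κ κ ℂ) p.2 q.2 else 0
  inv := Matrix.of fun p q =>
    if p.1 = q.1 then (((D p.1)⁻¹ : GL κ ℂ) : Matrix κ κ ℂ) p.2 q.2 else 0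
  val_inv := by
    ext ⟨i, k⟩ ⟨j, l⟩
    have h := congrFun (congrFun (Units.mul_inv (D i)) k) l
    rw [Matrix.mul_apply] at h
    rw [Matrix.mul_apply, Fintype.sum_prod_type, Finset.sum_eq_single i]
    · by_cases hij : i = j
      · subst hij
        simpa [Matrix.one_apply] using h
      · simp [hij]
    · intro x _ hx
      simp [Ne.symm hx]
    · simp
  inv_val := by
    ext ⟨i, k⟩ ⟨j, l⟩
    have h := congrFun (congrFun (Units.inv_mul (D i)) k) l
    rw [Matrix.mul_apply] at h
    rw [Matrix.mul_apply, Fintype.sum_prod_type, Finset.sum_eq_single i]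
    · by_cases hij : i = j
      · subst hij
        simpa [Matrix.one_apply] using h
      · simp [hij]
    · intro x _ hx
      simp [Ne.symm hx]
    · simp

/-- `R = diag(I_m, Q_m^b, Q_m^{2b}, …, Q_m^{(n-1)b})` with `b = m / gcd(n,m)`. -/
def matR (n m : ℕ) [NeZero n] [NeZero m] : GL (ZMod n × ZMod m) ℂ :=
  blockDiagGL fun k : ZMod n => pauliQ m ^ (k.val * (m / Nat.gcd n m))

/-! The group `𝒢_{n,m,d,a,b}`. Elements of `M_4(ℤ)` are written as `2 × 2` block matrices with
blocks in `M_2(ℤ)`. -/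

/-- The conditions on positive integers `n, m, d, a, b` under which `𝒢_{n,m,d,a,b}` is
defined. -/
structure Admissible (n m d a b : ℕ) : Prop where
  n_pos : 0 < n
  m_pos : 0 < m
  d_pos : 0 < d
  a_pos : 0 < a
  b_pos : 0 < b
  d_dvd_n : d ∣ n
  d_dvd_m : d ∣ m
  n_dvd : n ∣ a * b * d
  m_dvd : m ∣ a * b * d

/-- The admissible parameters `d = gcd(n,m)`, `a = n/d`, `b = m/d`. -/
theorem admissible_gcd (n m : ℕ) [NeZero n] [NeZero m] :
    Admissible n m (Nat.gcd n m) (n / Nat.gcd n m) (m / Nat.gcd n m) := by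
  have hn : 0 < n := NeZero.pos n
  have hm : 0 < m := NeZero.pos m
  have hd : 0 < Nat.gcd n m := Nat.gcd_pos_of_pos_left m hn
  have h1 := Nat.gcd_dvd_left n m
  have h2 := Nat.gcd_dvd_right n m
  refine ⟨hn, hm, hd, Nat.div_pos (Nat.le_of_dvd hn h1) hd,
    Nat.div_pos (Nat.le_of_dvd hm h2) hd, h1, h2, ?_, ?_⟩
  · rw [mul_right_comm, Nat.div_mul_cancel h1]
    exact dvd_mul_right _ _
  · rw [mul_assoc, Nat.div_mul_cancel h2]
    exact dvd_mul_left _ _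

/-- `M_2(ℤ)`. -/
abbrev M2 : Type := Matrix (Fin 2) (Fin 2) ℤ

/-- `M_4(ℤ)`, as block matrices. -/
abbrev M4 : Type := Matrix (Fin 2 ⊕ Fin 2) (Fin 2 ⊕ Fin 2) ℤ

/-- The block matrix with rows `(A₁₁, a A₁₂)` and `(b A₂₁, A₂₂)`. -/
def blockMat (a b : ℕ) (A₁₁ A₁₂ A₂₁ A₂₂ : M2) : M4 :=
  Matrix.fromBlocks A₁₁ ((a : ℤ) • A₁₂) ((b : ℤ) • A₂₁) A₂₂

theorem blockMat_mul (a b : ℕ) (A₁₁ A₁₂ A₂₁ A₂₂ B₁₁ B₁₂ B₂₁ B₂₂ : M2) :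
    blockMat a b A₁₁ A₁₂ A₂₁ A₂₂ * blockMat a b B₁₁ B₁₂ B₂₁ B₂₂ =
      blockMat a b (A₁₁ * B₁₁ + ((a : ℤ) * b) • (A₁₂ * B₂₁)) (A₁₁ * B₁₂ + A₁₂ * B₂₂)
        (A₂₁ * B₁₁ + A₂₂ * B₂₁) (((a : ℤ) * b) • (A₂₁ * B₁₂) + A₂₂ * B₂₂) := by
  simp only [blockMat, Matrix.fromBlocks_multiply, Matrix.smul_mul, Matrix.mul_smul, smul_add,
    smul_smul, mul_comm (b : ℤ) (a : ℤ)]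

theorem blockMat_one (a b : ℕ) : blockMat a b 1 0 0 1 = 1 := by
  simp [blockMat]

/-- The monoid `𝒮` of all matrices with rows `(A₁₁, a A₁₂)`, `(b A₂₁, A₂₂)`, `A_{ij} ∈ M_2(ℤ)`. -/
def monoidS (a b : ℕ) : Submonoid M4 where
  carrier := {A | ∃ A₁₁ A₁₂ A₂₁ A₂₂ : M2, A = blockMat a b A₁₁ A₁₂ A₂₁ A₂₂}
  mul_mem' := by
    rintro _ _ ⟨A₁₁, A₁₂, A₂₁, A₂₂, rfl⟩ ⟨B₁₁, B₁₂, B₂₁, B₂₂, rfl⟩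
    exact ⟨_, _, _, _, blockMat_mul ..⟩
  one_mem' := ⟨1, 0, 0, 1, (blockMat_one a b).symm⟩

/-- The element of `𝒮` with blocks `A₁₁`, `a A₁₂`, `b A₂₁`, `A₂₂`. -/
def mkS (a b : ℕ) (A₁₁ A₁₂ A₂₁ A₂₂ : M2) : monoidS a b :=
  ⟨blockMat a b A₁₁ A₁₂ A₂₁ A₂₂, A₁₁, A₁₂, A₂₁, A₂₂, rfl⟩

/-- The block `A₁₁` of a matrix in `𝒮`. -/
def blk11 {a b : ℕ} (A : monoidS a b) : M2 := A.1.toBlocks₁₁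

/-- The `A₁₂` of a matrix in `𝒮` with upper right block `a A₁₂` (the division is exact). -/
def blk12 {a b : ℕ} (A : monoidS a b) : M2 := A.1.toBlocks₁₂.map fun z => z / (a : ℤ)

/-- The `A₂₁` of a matrix in `𝒮` with lower left block `b A₂₁` (the division is exact). -/
def blk21 {a b : ℕ} (A : monoidS a b) : M2 := A.1.toBlocks₂₁.map fun z => z / (b : ℤ)

/-- The block `A₂₂` of a matrix in `𝒮`. -/
def blk22 {a b : ℕ} (A : monoidS a b) : M2 := A.1.toBlocks₂₂

/-- Entrywise congruence modulo `k`. -/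
def MatModEq (k : ℕ) (A B : M2) : Prop := ∀ i j, A i j ≡ B i j [ZMOD k]

/-- The relation `≡` on `𝒮`. -/
def EquivS (n m d : ℕ) {a b : ℕ} (A B : monoidS a b) : Prop :=
  MatModEq n (blk11 A) (blk11 B) ∧ MatModEq d (blk12 A) (blk12 B) ∧
    MatModEq d (blk21 A) (blk21 B) ∧ MatModEq m (blk22 A) (blk22 B)

/-- The operation `A ↦ A*` on `𝒮`, with rows `(A₁₁ᵀ, a A₂₁ᵀ)`, `(b A₁₂ᵀ, A₂₂ᵀ)`. -/
def starS {a b : ℕ} (A : monoidS a b) : monoidS a b :=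
  mkS a b (blk11 A).transpose (blk21 A).transpose (blk12 A).transpose (blk22 A).transpose

/-- `J_2`. -/
def matJ2 : M2 := !![0, 1; -1, 0]

/-- `J`, the block diagonal matrix with both diagonal blocks `J_2`, as an element of `𝒮`. -/
def matJ (a b : ℕ) : monoidS a b := mkS a b matJ2 0 0 matJ2

theorem exists_mkS {a b : ℕ} (A : monoidS a b) :
    ∃ A₁₁ A₁₂ A₂₁ A₂₂ : M2, A = mkS a b A₁₁ A₁₂ A₂₁ A₂₂ := by
  obtain ⟨_, A₁₁, A₁₂, A₂₁, A₂₂, rfl⟩ := A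
  exact ⟨A₁₁, A₁₂, A₂₁, A₂₂, rfl⟩

theorem mkS_mul (a b : ℕ) (A₁₁ A₁₂ A₂₁ A₂₂ B₁₁ B₁₂ B₂₁ B₂₂ : M2) :
    mkS a b A₁₁ A₁₂ A₂₁ A₂₂ * mkS a b B₁₁ B₁₂ B₂₁ B₂₂ =
      mkS a b (A₁₁ * B₁₁ + ((a : ℤ) * b) • (A₁₂ * B₂₁)) (A₁₁ * B₁₂ + A₁₂ * B₂₂)
        (A₂₁ * B₁₁ + A₂₂ * B₂₁) (((a : ℤ) * b) • (A₂₁ * B₁₂) + A₂₂ * B₂₂) :=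
  Subtype.ext (blockMat_mul ..)

theorem blk11_mkS (a b : ℕ) (A₁₁ A₁₂ A₂₁ A₂₂ : M2) :
    blk11 (mkS a b A₁₁ A₁₂ A₂₁ A₂₂) = A₁₁ := by
  simp [blk11, mkS, blockMat]

theorem blk22_mkS (a b : ℕ) (A₁₁ A₁₂ A₂₁ A₂₂ : M2) :
    blk22 (mkS a b A₁₁ A₁₂ A₂₁ A₂₂) = A₂₂ := by
  simp [blk22, mkS, blockMat]

theorem blk12_mkS {a : ℕ} (b : ℕ) (ha : 0 < a) (A₁₁ A₁₂ A₂₁ A₂₂ : M2) :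
    blk12 (mkS a b A₁₁ A₁₂ A₂₁ A₂₂) = A₁₂ := by
  have : (a : ℤ) ≠ 0 := by positivity
  ext i j
  change ((a : ℤ) * A₁₂ i j) / (a : ℤ) = A₁₂ i j
  exact Int.mul_ediv_cancel_left _ this

theorem blk21_mkS (a : ℕ) {b : ℕ} (hb : 0 < b) (A₁₁ A₁₂ A₂₁ A₂₂ : M2) :
    blk21 (mkS a b A₁₁ A₁₂ A₂₁ A₂₂) = A₂₁ := by
  have : (b : ℤ) ≠ 0 := by positivity
  ext i j
  change ((b : ℤ) * A₂₁ i j) / (b : ℤ) = A₂₁ i j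
  exact Int.mul_ediv_cancel_left _ this

theorem starS_mkS {a b : ℕ} (ha : 0 < a) (hb : 0 < b) (A₁₁ A₁₂ A₂₁ A₂₂ : M2) :
    starS (mkS a b A₁₁ A₁₂ A₂₁ A₂₂) =
      mkS a b A₁₁.transpose A₂₁.transpose A₁₂.transpose A₂₂.transpose := by
  rw [starS, blk11_mkS, blk22_mkS, blk12_mkS b ha, blk21_mkS a hb]

theorem starS_mul {a b : ℕ} (ha : 0 < a) (hb : 0 < b) (A B : monoidS a b) :
    starS (A * B) = starS B * starS A := by
  obtain ⟨A₁₁, A₁₂, A₂₁, A₂₂, rfl⟩ := exists_mkS A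
  obtain ⟨B₁₁, B₁₂, B₂₁, B₂₂, rfl⟩ := exists_mkS B
  simp only [mkS_mul, starS_mkS ha hb, Matrix.transpose_add, Matrix.transpose_mul,
    Matrix.transpose_smul]

theorem starS_one {a b : ℕ} (ha : 0 < a) (hb : 0 < b) : starS (1 : monoidS a b) = 1 := by
  have h : (1 : monoidS a b) = mkS a b 1 0 0 1 := Subtype.ext (blockMat_one a b).symm
  rw [h, starS_mkS ha hb]
  simp

theorem MatModEq.refl (k : ℕ) (A : M2) : MatModEq k A A := fun _ _ => Int.ModEq.refl _

theorem MatModEq.of_dvd {k l : ℕ} {A B : M2} (h : MatModEq l A B) (hkl : k ∣ l) :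
    MatModEq k A B :=
  fun i j => (h i j).of_dvd (Int.natCast_dvd_natCast.2 hkl)

theorem MatModEq.add {k : ℕ} {A B C D : M2} (h : MatModEq k A B) (h' : MatModEq k C D) :
    MatModEq k (A + C) (B + D) :=
  fun i j => (h i j).add (h' i j)

theorem MatModEq.mul {k : ℕ} {A B C D : M2} (h : MatModEq k A B) (h' : MatModEq k C D) :
    MatModEq k (A * C) (B * D) := by
  intro i j
  simp only [Matrix.mul_apply, Fin.sum_univ_two]
  exact ((h i 0).mul (h' 0 j)).add ((h i 1).mul (h' 1 j))

theorem MatModEq.smul {k d c : ℕ} {A B : M2} (h : MatModEq d A B) (hk : k ∣ c * d) :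
    MatModEq k ((c : ℤ) • A) ((c : ℤ) • B) := by
  intro i j
  have h1 : (c : ℤ) * A i j ≡ (c : ℤ) * B i j [ZMOD (c : ℤ) * d] := (h i j).mul_left'
  refine h1.of_dvd ?_
  exact_mod_cast hk

theorem MatModEq.transpose {k : ℕ} {A B : M2} (h : MatModEq k A B) :
    MatModEq k A.transpose B.transpose :=
  fun i j => h j i

variable {n m d a b : ℕ}

/-- The relation `≡` as a congruence of the monoid `𝒮`. -/
def congrS (h : Admissible n m d a b) : Con (monoidS a b) where
  r := EquivS n m d
  iseqv :=
    ⟨fun A => ⟨.refl _ _, .refl _ _, .refl _ _, .refl _ _⟩,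
      fun ⟨h1, h2, h3, h4⟩ => ⟨fun i j => (h1 i j).symm, fun i j => (h2 i j).symm,
        fun i j => (h3 i j).symm, fun i j => (h4 i j).symm⟩,
      fun ⟨h1, h2, h3, h4⟩ ⟨k1, k2, k3, k4⟩ => ⟨fun i j => (h1 i j).trans (k1 i j),
        fun i j => (h2 i j).trans (k2 i j), fun i j => (h3 i j).trans (k3 i j),
        fun i j => (h4 i j).trans (k4 i j)⟩⟩
  mul' := by
    intro A A' B B' hA hB
    obtain ⟨A₁₁, A₁₂, A₂₁, A₂₂, rfl⟩ := exists_mkS A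
    obtain ⟨B₁₁, B₁₂, B₂₁, B₂₂, rfl⟩ := exists_mkS B
    obtain ⟨C₁₁, C₁₂, C₂₁, C₂₂, rfl⟩ := exists_mkS A'
    obtain ⟨D₁₁, D₁₂, D₂₁, D₂₂, rfl⟩ := exists_mkS B'
    simp only [EquivS, mkS_mul, blk11_mkS, blk22_mkS, blk12_mkS b h.a_pos,
      blk21_mkS a h.b_pos] at hA hB ⊢
    obtain ⟨h1, h2, h3, h4⟩ := hA
    obtain ⟨k1, k2, k3, k4⟩ := hB
    have e : ((a : ℤ) * b) = ((a * b : ℕ) : ℤ) := by push_cast; rfl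
    rw [e]
    exact ⟨(h1.mul k1).add ((h2.mul k3).smul h.n_dvd),
      ((h1.of_dvd h.d_dvd_n).mul k2).add (h2.mul (k4.of_dvd h.d_dvd_m)),
      (h3.mul (k1.of_dvd h.d_dvd_n)).add ((h4.of_dvd h.d_dvd_m).mul k3),
      ((h3.mul k2).smul h.m_dvd).add (h4.mul k4)⟩

theorem EquivS.starS (h : Admissible n m d a b) {A B : monoidS a b} (hAB : EquivS n m d A B) :
    EquivS n m d (starS A) (starS B) := by
  obtain ⟨A₁₁, A₁₂, A₂₁, A₂₂, rfl⟩ := exists_mkS A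
  obtain ⟨B₁₁, B₁₂, B₂₁, B₂₂, rfl⟩ := exists_mkS B
  simp only [EquivS, starS_mkS h.a_pos h.b_pos, blk11_mkS, blk22_mkS, blk12_mkS b h.a_pos,
    blk21_mkS a h.b_pos] at hAB ⊢
  exact ⟨hAB.1.transpose, hAB.2.2.1.transpose, hAB.2.1.transpose, hAB.2.2.2.transpose⟩

/-- The operation `[A] ↦ [A]* = [A*]` on the quotient monoid `𝒮/≡`. -/
def starQ (h : Admissible n m d a b) : (congrS h).Quotient → (congrS h).Quotient :=
  Quotient.map' starS fun _ _ hAB => EquivS.starS h hAB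

/-- The class `j = [J]` in `𝒮/≡`. -/
def clsJ (h : Admissible n m d a b) : (congrS h).Quotient := (matJ a b : monoidS a b)

theorem starQ_mul (h : Admissible n m d a b) (x y : (congrS h).Quotient) :
    starQ h (x * y) = starQ h y * starQ h x := by
  induction x using Con.induction_on with | _ A
  induction y using Con.induction_on with | _ B
  exact congrArg (fun C : monoidS a b => (C : (congrS h).Quotient))
    (starS_mul h.a_pos h.b_pos A B)

theorem starQ_one (h : Admissible n m d a b) : starQ h 1 = 1 :=
  congrArg (fun C : monoidS a b => (C : (congrS h).Quotient)) (starS_one h.a_pos h.b_pos)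

/-- `𝒢_{n,m,d,a,b} = {x ∈ 𝒮/≡ | x* j x = j}`, with the multiplication of `𝒮/≡`. -/
def symGroup (h : Admissible n m d a b) : Submonoid (congrS h).Quotient where
  carrier := {x | starQ h x * clsJ h * x = clsJ h}
  mul_mem' := by
    intro x y (hx : starQ h x * clsJ h * x = clsJ h) (hy : starQ h y * clsJ h * y = clsJ h)
    change starQ h (x * y) * clsJ h * (x * y) = clsJ h
    calc starQ h (x * y) * clsJ h * (x * y)
        = starQ h y * (starQ h x * clsJ h * x) * y := by
          rw [starQ_mul]; simp only [mul_assoc]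
      _ = clsJ h := by rw [hx, hy]
  one_mem' := by
    change starQ h 1 * clsJ h * 1 = clsJ h
    rw [starQ_one, one_mul, mul_one]

end

end FiniteHeisenberg

namespace FiniteHeisenberg

noncomputable section

/-! Weyl operators over a finite commutative ring with a primitive additive character. -/

section Weyl

variable {K : Type} [Fintype K] [DecidableEq K]

/-! Modulo scalars, tensor products of Pauli matrices are Weyl operators W(v) = diag(ψ(v₁ i)) ·
shift(v₂) over the ring K = ℤ_n × ℤ_m, where v runs through the phase space K × K and ψ is the
product of the two standard characters. Since ψ is primitive, v ↦ Ad W(v) embeds K × K into Int(GL)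
(`phi_injective`), and the image is 𝒫_n ⊗ 𝒫_m (`pauliTensor_eq_weylGroup`). An element of the
normalizer thus acts on the phase space by an additive map, which preserves the commutation form of
the Weyl operators (`symplectic_of_conj`). The action is trivial exactly on 𝒫_n ⊗ 𝒫_m itself
(`mem_weylGroup_of_commute`).

Additive endomorphisms of the phase space are classes in 𝒮/≡: a homomorphism ℤ_n → ℤ_m is
multiplication by b·c with c determined modulo d, and likewise with a in the other direction
(`exists_realizes`, `equivS_iff_castPhase`). Preservation of the form becomes x*jx = j
(`Realizes.mem_symGroup`), so the quotient of the normalizer embeds into 𝒢.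

Surjectivity and the generation statement both follow from one fact: every class in 𝒢 is the action
of some element of the group generated by 𝒩(𝒫_n) ⊗ 𝒩(𝒫_m) and Ad_R (`attained_of_mem_symGroup`).
Fourier matrices and quadratic phases realize SL(2,ℤ) × SL(2,ℤ) (`exists_conj_SL2`), and R realizes
a shear coupling the two blocks (`realizes_matR`). Symplectic Gaussian elimination with these moves
brings every matrix in 𝒢 to the identity. A priori 𝒢 is only a monoid; the multiplicative bijection
with a quotient group makes it a group. It is finite because 𝒮/≡ is. -/

theorem diagGL_val (u : K → ℂˣ) :
    ((diagGL u : GL K ℂ) : Matrix K K ℂ) = Matrix.diagonal fun i => (u i : ℂ) := rfl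

theorem diagGL_mul (u v : K → ℂˣ) : diagGL u * diagGL v = diagGL (fun i => u i * v i) := by
  apply Units.ext
  simp [diagGL_val, Matrix.diagonal_mul_diagonal]

theorem diagGL_one : diagGL (fun _ : K => (1 : ℂˣ)) = 1 := by
  apply Units.ext
  simp [diagGL_val]

theorem diagGL_pow (u : K → ℂˣ) (k : ℕ) : diagGL u ^ k = diagGL (fun i => u i ^ k) := by
  induction k with
  | zero => simp [diagGL_one]
  | succ k ih => simp [pow_succ, ih, diagGL_mul]

/-- The scalar matrix `c`. -/
def scal (c : ℂˣ) : GL K ℂ := diagGL fun _ => c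

theorem scal_mul_val (c : ℂˣ) (A : GL K ℂ) :
    ((scal c * A : GL K ℂ) : Matrix K K ℂ) = (c : ℂ) • (A : Matrix K K ℂ) := by
  ext i j
  simp [scal, diagGL_val]

theorem scal_mul (c c' : ℂˣ) : (scal c * scal c' : GL K ℂ) = scal (c * c') := diagGL_mul _ _

theorem scal_comm (c : ℂˣ) (A : GL K ℂ) : scal c * A = A * scal c := by
  apply Units.ext
  ext i j
  simp [scal, diagGL_val, mul_comm]

theorem scal_injective [Nonempty K] : Function.Injective (scal : ℂˣ → GL K ℂ) := by
  intro c c' h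
  have i : K := Classical.arbitrary K
  have h1 := congrArg (fun A : GL K ℂ => (A : Matrix K K ℂ) i i) h
  exact Units.ext (by simpa [scal, diagGL_val] using h1)

/-! ### Inner automorphisms as matrices modulo scalars. -/

theorem Ad_mul_apply (M A : GL K ℂ) : Ad M * Ad A * (Ad M)⁻¹ = Ad (M * A * M⁻¹) := by
  simp

theorem Ad_surjective (x : IntGL K) : ∃ M, Ad M = x :=
  MonoidHom.rangeRestrict_surjective _ x

theorem Ad_eq_one_iff (A : GL K ℂ) : Ad A = 1 ↔ ∃ c : ℂˣ, A = scal c := by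
  have h : Ad A = 1 ↔ A ∈ Subgroup.center (GL K ℂ) := by
    rw [Subgroup.mem_center_iff, Subtype.ext_iff]
    change MulAut.conj A = 1 ↔ _
    rw [MulEquiv.ext_iff]
    refine forall_congr' fun B => ?_
    rw [MulAut.conj_apply, MulAut.one_apply, mul_inv_eq_iff_eq_mul]
    exact eq_comm
  rw [h, Matrix.GeneralLinearGroup.center_eq_range_scalar]
  refine exists_congr fun c => ?_
  rw [eq_comm, Units.ext_iff, Units.ext_iff]
  rfl

theorem Ad_eq_iff (A B : GL K ℂ) : Ad A = Ad B ↔ ∃ c : ℂˣ, A = scal c * B := by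
  rw [← mul_inv_eq_one, ← map_inv, ← map_mul, Ad_eq_one_iff]
  simp [mul_inv_eq_iff_eq_mul]

theorem Ad_scal (c : ℂˣ) : Ad (scal c : GL K ℂ) = 1 := (Ad_eq_one_iff _).2 ⟨c, rfl⟩

theorem Ad_scal_mul (c : ℂˣ) (A : GL K ℂ) : Ad (scal c * A) = Ad A := by
  rw [map_mul, Ad_scal, one_mul]

variable [CommRing K]

/-- The translation matrix, with entries `δ_{i + l, j}`. -/
def shiftGL (l : K) : GL K ℂ where
  val := Matrix.of fun i j => if i + l = j then 1 else 0
  inv := Matrix.of fun i j => if i - l = j then 1 else 0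
  val_inv := by
    ext i j
    rw [Matrix.mul_apply, Finset.sum_eq_single (i + l)]
    · simp [Matrix.one_apply]
    · intro k _ hk
      simp [Ne.symm hk]
    · simp
  inv_val := by
    ext i j
    rw [Matrix.mul_apply, Finset.sum_eq_single (i - l)]
    · simp [Matrix.one_apply]
    · intro k _ hk
      simp [Ne.symm hk]
    · simp

theorem shiftGL_val (l : K) :
    ((shiftGL l : GL K ℂ) : Matrix K K ℂ) = Matrix.of fun i j => if i + l = j then 1 else 0 := rfl

theorem shiftGL_mul (l l' : K) : shiftGL l * shiftGL l' = shiftGL (l + l') := by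
  apply Units.ext
  ext i j
  rw [Units.val_mul, Matrix.mul_apply, Finset.sum_eq_single (i + l)]
  · simp [shiftGL_val, add_assoc]
  · intro k _ hk
    simp [shiftGL_val, Ne.symm hk]
  · simp

theorem shiftGL_zero : shiftGL (0 : K) = 1 := by
  apply Units.ext
  ext i j
  simp [shiftGL_val, Matrix.one_apply]

theorem shiftGL_mul_diagGL (l : K) (u : K → ℂˣ) :
    shiftGL l * diagGL u = diagGL (fun i => u (i + l)) * shiftGL l := by
  apply Units.ext
  ext i j
  simp only [Units.val_mul, shiftGL_val, diagGL_val, Matrix.mul_diagonal, Matrix.diagonal_mul,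
    Matrix.of_apply]
  split_ifs with h
  · simp [h]
  · simp

variable (ψ : AddChar K ℂˣ)

/-- The Weyl operator `diag(ψ(v₁ i)) · shift(v₂)`. -/
def weyl (v : K × K) : GL K ℂ := diagGL (fun i => ψ (v.1 * i)) * shiftGL v.2

theorem weyl_apply (v : K × K) (i j : K) :
    (weyl ψ v : Matrix K K ℂ) i j = if i + v.2 = j then (ψ (v.1 * i) : ℂ) else 0 := by
  simp [weyl, diagGL_val, shiftGL_val]

theorem weyl_mul (v w : K × K) :
    weyl ψ v * weyl ψ w = scal (ψ (w.1 * v.2)) * weyl ψ (v + w) := by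
  rw [weyl, weyl, weyl, mul_assoc, ← mul_assoc (shiftGL _), shiftGL_mul_diagGL, mul_assoc,
    shiftGL_mul, ← mul_assoc, ← mul_assoc, diagGL_mul, scal, diagGL_mul]
  congr 2
  funext i
  simp only [Prod.fst_add, add_mul, mul_add, AddChar.map_add_eq_mul]
  ac_rfl

theorem weyl_zero : weyl ψ 0 = 1 := by
  simp [weyl, shiftGL_zero, diagGL_one]

/-- The class of the Weyl operator in `Int(GL)`, as a homomorphism on the phase space. -/
def weylHom : Multiplicative (K × K) →* IntGL K where
  toFun v := Ad (weyl ψ v.toAdd)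
  map_one' := by simp [weyl_zero]
  map_mul' v w := by rw [← map_mul, weyl_mul, Ad_scal_mul]; rfl

/-- The inner automorphism given by a Weyl operator. -/
def phi (v : K × K) : IntGL K := Ad (weyl ψ v)

theorem phi_add (v w : K × K) : phi ψ (v + w) = phi ψ v * phi ψ w :=
  map_mul (weylHom ψ) (Multiplicative.ofAdd v) (Multiplicative.ofAdd w)

theorem phi_zero : phi ψ 0 = 1 := map_one (weylHom ψ)

theorem phi_neg (v : K × K) : phi ψ (-v) = (phi ψ v)⁻¹ :=
  map_inv (weylHom ψ) (Multiplicative.ofAdd v)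

theorem phi_nsmul (k : ℕ) (v : K × K) : phi ψ (k • v) = phi ψ v ^ k :=
  map_pow (weylHom ψ) (Multiplicative.ofAdd v) k

/-- The group of inner automorphisms given by Weyl operators. -/
def weylGroup : Subgroup (IntGL K) := (weylHom ψ).range

theorem mem_weylGroup {x : IntGL K} : x ∈ weylGroup ψ ↔ ∃ v, phi ψ v = x :=
  ⟨fun ⟨v, hv⟩ => ⟨v.toAdd, hv⟩, fun ⟨v, hv⟩ => ⟨Multiplicative.ofAdd v, hv⟩⟩

theorem phi_mem (v : K × K) : phi ψ v ∈ weylGroup ψ := (mem_weylGroup ψ).2 ⟨v, rfl⟩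

instance : Finite (weylGroup ψ) := by
  unfold weylGroup
  have : Finite (Multiplicative (K × K)) := inferInstanceAs (Finite (K × K))
  exact Finite.of_surjective _ (weylHom ψ).rangeRestrict_surjective

/-- Conjugation is injective and the Weyl group is finite, so mapping the group into itself already
forces equality. -/
theorem mem_normalizer_weylGroup {x : IntGL K} :
    x ∈ Subgroup.normalizer (weylGroup ψ : Set (IntGL K)) ↔
      ∀ v, ∃ w, x * phi ψ v * x⁻¹ = phi ψ w := by
  constructor
  · intro hx v
    obtain ⟨w, hw⟩ := (mem_weylGroup ψ).1 ((hx _).1 (phi_mem ψ v))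
    exact ⟨w, hw.symm⟩
  · intro h
    have : Finite (weylGroup ψ : Set (IntGL K)) := inferInstanceAs (Finite (weylGroup ψ))
    refine Subgroup.mem_normalizer_fintype fun y hy => ?_
    obtain ⟨v, rfl⟩ := (mem_weylGroup ψ).1 hy
    obtain ⟨w, hw⟩ := h v
    rw [hw]
    exact phi_mem ψ w

variable {ψ}

theorem exists_char_ne_one (hψ : ψ.IsPrimitive) {a : K} (ha : a ≠ 0) : ∃ k, ψ (k * a) ≠ 1 := by
  obtain ⟨k, hk⟩ := AddChar.ne_one_iff.1 (hψ ha)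
  exact ⟨k, by rwa [AddChar.mulShift_apply, mul_comm] at hk⟩

theorem eq_of_char_eq (hψ : ψ.IsPrimitive) {a b : K} (h : ∀ k, ψ (k * a) = ψ (k * b)) :
    a = b := by
  by_contra hab
  obtain ⟨k, hk⟩ := exists_char_ne_one hψ (sub_ne_zero.2 hab)
  rw [mul_sub, AddChar.map_sub_eq_div, h k, div_self'] at hk
  exact hk rfl

/-- A scalar Weyl operator has no shift, since row 0 has its nonzero entry in column v₂; its
diagonal ψ(v₁ i) is then constant, which primitivity allows only for v₁ = 0. -/
theorem phi_injective (hψ : ψ.IsPrimitive) : Function.Injective (phi ψ) := by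
  have key : ∀ v, phi ψ v = 1 → v = 0 := by
    rintro ⟨p, l⟩ h
    obtain ⟨c, hc⟩ := (Ad_eq_one_iff _).1 h
    have hc' : ∀ i j, (weyl ψ (p, l) : Matrix K K ℂ) i j = if i = j then (c : ℂ) else 0 := by
      intro i j
      rw [hc, scal, diagGL_val, Matrix.diagonal_apply]
    have hl : l = 0 := by
      by_contra hl
      have h0 := hc' 0 l
      rw [weyl_apply] at h0
      simp [Ne.symm hl] at h0
    subst hl
    have h1 : ∀ i, ψ (p * i) = c := by
      intro i
      have := hc' i i
      rw [weyl_apply] at this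
      exact Units.ext (by simpa using this)
    have hp : p = 0 := eq_of_char_eq hψ fun k => by
      rw [mul_comm, h1, mul_comm, ← h1 0, mul_zero, zero_mul]
    rw [hp]
    rfl
  intro v w h
  have := key (v - w) (by rw [sub_eq_add_neg, phi_add, phi_neg, h, mul_inv_cancel])
  exact sub_eq_zero.1 this

/-- Matrices commuting with all Weyl operators are scalar. -/
theorem eq_scal_of_commute (hψ : ψ.IsPrimitive) (M : GL K ℂ)
    (h : ∀ v, M * weyl ψ v = weyl ψ v * M) : ∃ c, M = scal c := by
  rw [← Ad_eq_one_iff, Ad_eq_one_iff]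
  -- Commuting with the diagonal Weyl operators makes M diagonal, because the characters ψ(k ·)
  -- separate points.
  have hd : ∀ i j, i ≠ j → (M : Matrix K K ℂ) i j = 0 := by
    intro i j hij
    obtain ⟨k, hk⟩ := exists_char_ne_one hψ (sub_ne_zero.2 hij)
    have h1 := congrArg (fun A : GL K ℂ => (A : Matrix K K ℂ) i j) (h (k, 0))
    simp only [weyl, shiftGL_zero, mul_one, Units.val_mul, diagGL_val, Matrix.mul_diagonal,
      Matrix.diagonal_mul] at h1
    by_contra hM
    rw [mul_comm] at h1
    have h2 := Units.ext (mul_right_cancel₀ hM h1)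
    rw [mul_sub, AddChar.map_sub_eq_div, h2, div_self'] at hk
    exact hk rfl
  -- Commuting with the shifts makes the diagonal constant: compare the entries (0, i).
  have hc : ∀ i, (M : Matrix K K ℂ) i i = (M : Matrix K K ℂ) 0 0 := by
    intro i
    have h1 := congrArg (fun A : GL K ℂ => (A : Matrix K K ℂ) 0 i) (h (0, i))
    have e : weyl ψ (0, i) = shiftGL i := by simp [weyl, diagGL_one]
    simp only [e, Units.val_mul, shiftGL_val, Matrix.mul_apply, Matrix.of_apply] at h1
    rw [Finset.sum_eq_single 0, Finset.sum_eq_single i] at h1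
    · simpa using h1.symm
    · intro j _ hj
      simp [Ne.symm hj]
    · simp
    · intro j _ hj
      simp [hd 0 j (Ne.symm hj)]
    · simp
  have h0 : (M : Matrix K K ℂ) 0 0 ≠ 0 := by
    intro h0
    have hz : (M : Matrix K K ℂ) = 0 := by
      ext i j
      by_cases hij : i = j
      · subst hij; rw [hc, h0]; rfl
      · exact hd i j hij
    have h1 := congrArg (fun A : Matrix K K ℂ => A 0 0) (M.mul_inv)
    simp [hz] at h1
  refine ⟨Units.mk0 _ h0, Units.ext ?_⟩
  ext i j
  rw [scal, diagGL_val, Matrix.diagonal_apply]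
  split_ifs with hij
  · subst hij; exact hc i
  · exact hd i j hij

theorem weyl_commutation (v w : K × K) :
    weyl ψ v * weyl ψ w = scal (ψ (w.1 * v.2 - v.1 * w.2)) * (weyl ψ w * weyl ψ v) := by
  rw [weyl_mul, weyl_mul, ← mul_assoc, scal_mul, ← AddChar.map_add_eq_mul, add_comm w v]
  congr 3
  ring

/-- Conjugation acts on the phase space by symplectic maps. -/
theorem symplectic_of_conj {x : IntGL K} {v v' w w' : K × K}
    (hv : x * phi ψ v * x⁻¹ = phi ψ v') (hw : x * phi ψ w * x⁻¹ = phi ψ w') :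
    ψ (w.1 * v.2 - v.1 * w.2) = ψ (w'.1 * v'.2 - v'.1 * w'.2) := by
  obtain ⟨M, rfl⟩ := Ad_surjective x
  rw [phi, phi, Ad_mul_apply, Ad_eq_iff] at hv hw
  obtain ⟨c, hc⟩ := hv
  obtain ⟨c', hc'⟩ := hw
  have : Nonempty K := ⟨0⟩
  apply scal_injective (K := K)
  -- Conjugation fixes the scalar commutator of two Weyl operators, and the ambiguity c, c' of the
  -- lifts enters both orders of the product equally, so it cancels.
  have h1 : scal (c * c') * (weyl ψ v' * weyl ψ w') =
      scal (ψ (w.1 * v.2 - v.1 * w.2)) * (scal (c * c') * (weyl ψ w' * weyl ψ v')) := by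
    have e1 : scal (c * c') * (weyl ψ v' * weyl ψ w') =
        (scal c * weyl ψ v') * (scal c' * weyl ψ w') := by
      rw [← scal_mul, mul_assoc, mul_assoc, ← mul_assoc (scal c'), scal_comm c', mul_assoc]
    have e2 : scal (c * c') * (weyl ψ w' * weyl ψ v') =
        (scal c' * weyl ψ w') * (scal c * weyl ψ v') := by
      rw [mul_comm c, ← scal_mul, mul_assoc, mul_assoc, ← mul_assoc (scal c), scal_comm c, mul_assoc]
    rw [e1, e2, ← hc, ← hc']
    have e3 : M * weyl ψ v * M⁻¹ * (M * weyl ψ w * M⁻¹) = M * (weyl ψ v * weyl ψ w) * M⁻¹ := by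
      group
    have e4 : M * weyl ψ w * M⁻¹ * (M * weyl ψ v * M⁻¹) = M * (weyl ψ w * weyl ψ v) * M⁻¹ := by
      group
    rw [e3, e4, weyl_commutation, ← mul_assoc M, ← scal_comm]
    simp only [mul_assoc]
  rw [weyl_commutation v' w', ← mul_assoc, ← mul_assoc (scal (ψ _)), mul_left_inj, ← scal_comm,
    mul_left_inj] at h1
  exact h1.symm

/-- Every additive character is of the form `ψ(u ·)`. -/
theorem exists_eq_mulShift (hψ : ψ.IsPrimitive) (χ : AddChar K ℂˣ) :
    ∃ u, ∀ k, χ k = ψ (u * k) := by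
  let f : K → AddChar K ℂ := fun u => (Units.coeHom ℂ).compAddChar (ψ.mulShift u)
  have hf : Function.Bijective f := by
    -- K has exactly as many complex characters as elements, so injectivity of u ↦ ψ(u ·), which is
    -- primitivity, suffices.
    rw [Fintype.bijective_iff_injective_and_card, AddChar.card_eq]
    refine ⟨fun u v h => AddChar.to_mulShift_inj_of_isPrimitive hψ ?_, rfl⟩
    ext k
    exact congrArg (fun χ : AddChar K ℂ => χ k) h
  obtain ⟨u, hu⟩ := hf.2 ((Units.coeHom ℂ).compAddChar χ)
  refine ⟨u, fun k => Units.ext ?_⟩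
  exact (congrArg (fun χ : AddChar K ℂ => χ k) hu).symm

/-- An inner automorphism centralizing the Weyl group belongs to it. -/
theorem mem_weylGroup_of_commute (hψ : ψ.IsPrimitive) {x : IntGL K}
    (hx : ∀ v, x * phi ψ v * x⁻¹ = phi ψ v) : x ∈ weylGroup ψ := by
  obtain ⟨M, rfl⟩ := Ad_surjective x
  have : Nonempty K := ⟨0⟩
  have h1 : ∀ v, ∃ c, M * weyl ψ v = scal c * (weyl ψ v * M) := by
    intro v
    have := hx v
    rw [phi, Ad_mul_apply, Ad_eq_iff] at this
    obtain ⟨c, hc⟩ := this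
    exact ⟨c, by rw [← mul_assoc, ← hc, inv_mul_cancel_right]⟩
  choose c hc using h1
  -- The scalar by which M fails to commute with W(v) is a character of the phase space. It
  -- therefore equals the commutation scalar of some W(u) with W(v), and W(u)⁻¹M commutes with every
  -- Weyl operator.
  have hadd : ∀ v w, c (v + w) = c v * c w := by
    intro v w
    apply scal_injective (K := K)
    have e1 : M * (weyl ψ v * weyl ψ w) = scal (c v * c w) * ((weyl ψ v * weyl ψ w) * M) := by
      rw [← mul_assoc, hc, ← scal_mul, mul_assoc, mul_assoc, hc, ← mul_assoc (weyl ψ v),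
        ← scal_comm]
      simp only [mul_assoc]
    rw [weyl_mul, ← mul_assoc, ← scal_comm, mul_assoc, hc, ← mul_assoc, ← mul_assoc,
      ← mul_assoc, ← mul_assoc, mul_left_inj, mul_left_inj] at e1
    rw [scal_comm, mul_left_inj] at e1
    exact e1
  have hzero : c 0 = 1 := by
    have := hadd 0 0
    rw [add_zero] at this
    exact left_eq_mul.1 this
  let χ₁ : AddChar K ℂˣ :=
    { toFun k := c (k, 0)
      map_zero_eq_one' := hzero
      map_add_eq_mul' k l := by rw [← hadd]; simp }
  let χ₂ : AddChar K ℂˣ :=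
    { toFun k := c (0, k)
      map_zero_eq_one' := hzero
      map_add_eq_mul' k l := by rw [← hadd]; simp }
  obtain ⟨u₁, hu₁⟩ := exists_eq_mulShift hψ χ₁
  obtain ⟨u₂, hu₂⟩ := exists_eq_mulShift hψ χ₂
  -- The swap and the sign turn the pairing u₁v₁ + u₂v₂ into the symplectic form of
  -- `weyl_commutation`.
  set u : K × K := (-u₂, u₁) with hu
  have hcu : ∀ v, c v = ψ (v.1 * u.2 - u.1 * v.2) := by
    intro v
    have : c v = χ₁ v.1 * χ₂ v.2 := by
      change c v = c _ * c _
      rw [← hadd]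
      simp
    rw [this, hu₁, hu₂, ← AddChar.map_add_eq_mul]
    congr 1
    simp [hu]
    ring
  obtain ⟨e, he⟩ := eq_scal_of_commute hψ ((weyl ψ u)⁻¹ * M) (fun v => by
    rw [mul_assoc, hc, inv_mul_eq_iff_eq_mul, ← mul_assoc (weyl ψ u),
      weyl_commutation u v, hcu]
    simp only [mul_assoc, mul_inv_cancel_left])
  rw [inv_mul_eq_iff_eq_mul] at he
  rw [he, map_mul, Ad_scal, mul_one]
  exact phi_mem ψ u

/-- A diagonal matrix with quadratic phases acts on the phase space by a shear. -/
theorem conj_diagGL (g c : K → ℂˣ) (B : K → K)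
    (h : ∀ i l, g i = c l * ψ (B l * i) * g (i + l)) (v : K × K) :
    Ad (diagGL g) * phi ψ v * (Ad (diagGL g))⁻¹ = phi ψ (v.1 + B v.2, v.2) := by
  rw [phi, phi, Ad_mul_apply, Ad_eq_iff]
  refine ⟨c v.2, ?_⟩
  rw [mul_inv_eq_iff_eq_mul, weyl, weyl, mul_assoc, mul_assoc, shiftGL_mul_diagGL, scal,
    ← mul_assoc, ← mul_assoc, ← mul_assoc, diagGL_mul, diagGL_mul, diagGL_mul]
  congr 2
  funext i
  rw [h i v.2, add_mul, AddChar.map_add_eq_mul]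
  ac_rfl

theorem char_sum (hψ : ψ.IsPrimitive) (b : K) :
    ∑ x : K, (ψ (x * b) : ℂ) = if b = 0 then (Fintype.card K : ℂ) else 0 := by
  have hψ' : ((Units.coeHom ℂ).compAddChar ψ).IsPrimitive := by
    intro a ha h
    refine hψ ha ?_
    ext k
    exact congrArg (fun χ : AddChar K ℂ => χ k) h
  have := AddChar.sum_mulShift b hψ'
  simpa using this

/-- The (unnormalized) Fourier matrix. -/
def fourierGL (hψ : ψ.IsPrimitive) : GL K ℂ where
  val := Matrix.of fun i j => (ψ (i * j) : ℂ)
  inv := Matrix.of fun i j => (Fintype.card K : ℂ)⁻¹ * (ψ (-(i * j)) : ℂ)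
  val_inv := by
    ext i j
    have : Nonempty K := ⟨0⟩
    have h : ∀ k, (ψ (i * k) : ℂ) * ((Fintype.card K : ℂ)⁻¹ * (ψ (-(k * j)) : ℂ)) =
        (Fintype.card K : ℂ)⁻¹ * (ψ (k * (i - j)) : ℂ) := by
      intro k
      rw [mul_left_comm, ← Units.val_mul, ← AddChar.map_add_eq_mul]
      ring_nf
    simp only [Matrix.mul_apply, Matrix.of_apply, h, ← Finset.mul_sum, char_sum hψ,
      Matrix.one_apply, sub_eq_zero]
    split_ifs <;> simp
  inv_val := by
    ext i j
    have : Nonempty K := ⟨0⟩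
    have h : ∀ k, (Fintype.card K : ℂ)⁻¹ * (ψ (-(i * k)) : ℂ) * (ψ (k * j) : ℂ) =
        (Fintype.card K : ℂ)⁻¹ * (ψ (k * (j - i)) : ℂ) := by
      intro k
      rw [mul_assoc, ← Units.val_mul, ← AddChar.map_add_eq_mul]
      ring_nf
    simp only [Matrix.mul_apply, Matrix.of_apply, h, ← Finset.mul_sum, char_sum hψ,
      Matrix.one_apply, sub_eq_zero, eq_comm (a := j)]
    split_ifs <;> simp

theorem fourierGL_mul_weyl (hψ : ψ.IsPrimitive) (v : K × K) :
    fourierGL hψ * weyl ψ v = scal (ψ (-(v.1 * v.2))) * weyl ψ (-v.2, v.1) * fourierGL hψ := by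
  apply Units.ext
  ext i j
  rw [mul_assoc, scal_mul_val, Matrix.smul_apply, Units.val_mul, Units.val_mul, Matrix.mul_apply,
    Matrix.mul_apply, Finset.sum_eq_single (j - v.2), Finset.sum_eq_single (i + v.1)]
  · simp only [weyl_apply, fourierGL, Matrix.of_apply]
    simp only [sub_add_cancel, if_true, smul_eq_mul, ← Units.val_mul, ← AddChar.map_add_eq_mul]
    congr 2
    ring
  · intro k _ hk
    rw [weyl_apply, if_neg (Ne.symm hk), zero_mul]
  · simp
  · intro k _ hk
    rw [weyl_apply, if_neg (fun h => hk (eq_sub_of_add_eq h)), mul_zero]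
  · simp

theorem conj_fourierGL (hψ : ψ.IsPrimitive) (v : K × K) :
    Ad (fourierGL hψ) * phi ψ v * (Ad (fourierGL hψ))⁻¹ = phi ψ (-v.2, v.1) := by
  rw [phi, phi, Ad_mul_apply, Ad_eq_iff]
  exact ⟨_, by rw [mul_inv_eq_iff_eq_mul]; exact fourierGL_mul_weyl hψ v⟩

end Weyl

/-! The Weyl operators of `ZMod n`. -/

section Single

variable (n : ℕ) [NeZero n]

theorem omega_primitive : IsPrimitiveRoot (omega n) n :=
  IsPrimitiveRoot.coe_units_iff.1 (Complex.isPrimitiveRoot_exp n (NeZero.ne n))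

/-- The additive character `j ↦ ω_n^j`. -/
def pauliChar : AddChar (ZMod n) ℂˣ := AddChar.zmodChar n (omega_primitive n).pow_eq_one

theorem pauliChar_apply (x : ZMod n) : pauliChar n x = omega n ^ x.val := rfl

theorem pauliChar_primitive : (pauliChar n).IsPrimitive :=
  AddChar.zmodChar_primitive_of_primitive_root n (omega_primitive n)

theorem pauliChar_intCast (z : ℤ) : pauliChar n z = omega n ^ z := by
  have h : pauliChar n 1 = omega n := by
    have := AddChar.zmodChar_apply' (omega_primitive n).pow_eq_one 1
    simpa [pauliChar] using this
  rw [← h, ← AddChar.map_zsmul_eq_zpow, zsmul_one]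

theorem pauliQ_eq_weyl : pauliQ n = weyl (pauliChar n) (1, 0) := by
  simp only [weyl, one_mul, shiftGL_zero, mul_one]
  rfl

theorem pauliP_eq_weyl : pauliP n = weyl (pauliChar n) (0, 1) := by
  simp only [weyl, zero_mul, AddChar.map_zero_eq_one, diagGL_one, one_mul]
  apply Units.ext
  ext i j
  simp [pauliP, shiftGL_val, eq_sub_iff_add_eq]

theorem pauliGroup_eq_weylGroup : pauliGroup n = weylGroup (pauliChar n) := by
  apply le_antisymm
  · rw [pauliGroup, Subgroup.closure_le]
    rintro _ (rfl | rfl)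
    · rw [pauliQ_eq_weyl]; exact phi_mem _ _
    · rw [pauliP_eq_weyl]; exact phi_mem _ _
  · intro x hx
    obtain ⟨⟨p, l⟩, rfl⟩ := (mem_weylGroup _).1 hx
    have e : ((p, l) : ZMod n × ZMod n) = p.val • (1, 0) + l.val • (0, 1) := by
      simp
    rw [e, phi_add, phi_nsmul, phi_nsmul]
    refine mul_mem (pow_mem (Subgroup.subset_closure ?_) _)
      (pow_mem (Subgroup.subset_closure ?_) _)
    · left; rw [pauliQ_eq_weyl]; rfl
    · right; rw [pauliP_eq_weyl]; rfl

theorem map_heisenberg : (heisenberg n).map Ad = pauliGroup n := by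
  rw [heisenberg, MonoidHom.map_closure, Set.image_pair, pauliGroup]

/-- The phases `exp(πi z(n-z)/n)`, which are periodic in `z`. -/
def quadPhase (z : ℤ) : ℂˣ :=
  Units.mk0 (Complex.exp (Real.pi * Complex.I * (z * (n - z)) / n)) (Complex.exp_ne_zero _)

theorem quadPhase_add (z l : ℤ) :
    quadPhase n z = (quadPhase n l)⁻¹ * omega n ^ (l * z) * quadPhase n (z + l) := by
  apply Units.ext
  have hn : (n : ℂ) ≠ 0 := Nat.cast_ne_zero.2 (NeZero.ne n)
  simp only [Units.val_mul, Units.val_inv_eq_inv_val, Units.val_zpow_eq_zpow_val, quadPhase, omega,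
    Units.val_mk0, ← Complex.exp_int_mul, ← Complex.exp_neg, ← Complex.exp_add]
  congr 1
  push_cast
  field_simp
  ring

/-- The exponent is -πi·n·k(k-1), and k(k-1) is even. The linear term of the phase provides the -1;
the pure square z² would fail to be n-periodic for odd n. -/
theorem quadPhase_mul (k : ℤ) : quadPhase n (n * k) = 1 := by
  apply Units.ext
  have hn : (n : ℂ) ≠ 0 := Nat.cast_ne_zero.2 (NeZero.ne n)
  rw [quadPhase, Units.val_mk0, Units.val_one, Complex.exp_eq_one_iff]
  obtain ⟨c, hc⟩ := Int.even_mul_pred_self k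
  refine ⟨-(n * c), ?_⟩
  have hc' : (k : ℂ) * (k - 1) = c + c := by exact_mod_cast hc
  push_cast
  field_simp
  linear_combination -hc'

theorem quadPhase_periodic (z k : ℤ) : quadPhase n (z + n * k) = quadPhase n z := by
  rw [quadPhase_add n z (n * k), quadPhase_mul, mul_assoc (n : ℤ), zpow_mul, zpow_natCast,
    (omega_primitive n).pow_eq_one]
  simp

theorem quadPhase_val (z : ℤ) : quadPhase n ((z : ZMod n).val : ℤ) = quadPhase n z := by
  rw [ZMod.val_intCast]
  conv_rhs => rw [← Int.emod_add_mul_ediv z n]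
  rw [quadPhase_periodic]

/-- The diagonal matrix realizing the shear `(k, l) ↦ (k + l, l)`. -/
def shearGL : GL (ZMod n) ℂ := diagGL fun i => quadPhase n i.val

theorem conj_shearGL (v : ZMod n × ZMod n) :
    Ad (shearGL n) * phi (pauliChar n) v * (Ad (shearGL n))⁻¹ =
      phi (pauliChar n) (v.1 + v.2, v.2) := by
  refine conj_diagGL _ (fun l => (quadPhase n l.val)⁻¹) id (fun i l => ?_) v
  obtain ⟨i, rfl⟩ := ZMod.intCast_surjective i
  obtain ⟨l, rfl⟩ := ZMod.intCast_surjective l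
  rw [id, ← Int.cast_add, ← Int.cast_mul, pauliChar_intCast]
  simp only [quadPhase_val]
  exact quadPhase_add n i l

/-- The action of an integral `2 × 2` matrix on the phase space of `ZMod n`. -/
def act2 (s : Matrix (Fin 2) (Fin 2) ℤ) (v : ZMod n × ZMod n) : ZMod n × ZMod n :=
  (s 0 0 * v.1 + s 0 1 * v.2, s 1 0 * v.1 + s 1 1 * v.2)

theorem act2_mul (s t : Matrix (Fin 2) (Fin 2) ℤ) (v : ZMod n × ZMod n) :
    act2 n (s * t) v = act2 n s (act2 n t v) := by
  simp only [act2, Matrix.mul_apply, Fin.sum_univ_two]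
  push_cast
  ext <;> simp <;> ring

theorem act2_one (v : ZMod n × ZMod n) : act2 n 1 v = v := by
  simp [act2]

/-- Every element of `SL(2, ℤ)` is realized by an inner automorphism. -/
theorem exists_conj_SL2 (s : Matrix.SpecialLinearGroup (Fin 2) ℤ) :
    ∃ A : GL (ZMod n) ℂ, ∀ v, Ad A * phi (pauliChar n) v * (Ad A)⁻¹ =
      phi (pauliChar n) (act2 n s.1 v) := by
  have hs : s ∈ Subgroup.closure {ModularGroup.S, ModularGroup.T} := by
    rw [_root_.SpecialLinearGroup.SL2Z_generators]; trivial
  induction hs using Subgroup.closure_induction with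
  | mem s hs =>
    rcases hs with rfl | rfl
    · refine ⟨fourierGL (pauliChar_primitive n), fun v => ?_⟩
      rw [conj_fourierGL]
      simp [act2, ModularGroup.S]
    · refine ⟨shearGL n, fun v => ?_⟩
      rw [conj_shearGL]
      simp [act2, ModularGroup.T]
  | one => exact ⟨1, fun v => by simp [act2_one]⟩
  | mul s t _ _ hs ht =>
    obtain ⟨A, hA⟩ := hs
    obtain ⟨B, hB⟩ := ht
    refine ⟨A * B, fun v => ?_⟩
    rw [Matrix.SpecialLinearGroup.coe_mul, act2_mul, ← hA, ← hB, map_mul]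
    group
  | inv s _ hs =>
    obtain ⟨A, hA⟩ := hs
    refine ⟨A⁻¹, fun v => ?_⟩
    have h := hA (act2 n (s⁻¹).1 v)
    rw [← act2_mul, ← Matrix.SpecialLinearGroup.coe_mul, mul_inv_cancel,
      Matrix.SpecialLinearGroup.coe_one, act2_one] at h
    rw [← h, map_inv]
    group

theorem mem_normPauli {x : IntGL (ZMod n)} : x ∈ normPauli n ↔
    ∀ v, ∃ w, x * phi (pauliChar n) v * x⁻¹ = phi (pauliChar n) w := by
  rw [normPauli, pauliGroup_eq_weylGroup]
  exact mem_normalizer_weylGroup _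

end Single

/-! ### Tensor products as Weyl operators over a product ring. -/

section Tensor

variable {K K' : Type} [Fintype K] [DecidableEq K] [CommRing K] [Fintype K'] [DecidableEq K']
  [CommRing K']

theorem Ad_tensor_congr {A A' : GL K ℂ} {B B' : GL K' ℂ} (hA : Ad A = Ad A') (hB : Ad B = Ad B') :
    Ad (tensor A B) = Ad (tensor A' B') := by
  obtain ⟨c, rfl⟩ := (Ad_eq_iff _ _).1 hA
  obtain ⟨c', rfl⟩ := (Ad_eq_iff _ _).1 hB
  rw [Ad_eq_iff]
  refine ⟨c * c', ?_⟩
  apply Units.ext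
  ext i j
  rw [scal_mul_val]
  change (scal c * A' : GL K ℂ).val i.1 j.1 * (scal c' * B' : GL K' ℂ).val i.2 j.2 =
    ((c * c' : ℂˣ) : ℂ) * (A'.val i.1 j.1 * B'.val i.2 j.2)
  rw [scal_mul_val, scal_mul_val]
  simp only [Matrix.smul_apply, smul_eq_mul, Units.val_mul]
  ring

/-- The product of two additive characters, on the product ring. -/
def prodChar (ψ : AddChar K ℂˣ) (ψ' : AddChar K' ℂˣ) : AddChar (K × K') ℂˣ where
  toFun x := ψ x.1 * ψ' x.2
  map_zero_eq_one' := by simp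
  map_add_eq_mul' x y := by
    simp only [Prod.fst_add, Prod.snd_add, AddChar.map_add_eq_mul]
    ac_rfl

variable {ψ : AddChar K ℂˣ} {ψ' : AddChar K' ℂˣ}

theorem prodChar_apply (x : K × K') : prodChar ψ ψ' x = ψ x.1 * ψ' x.2 := rfl

theorem prodChar_primitive (hψ : ψ.IsPrimitive) (hψ' : ψ'.IsPrimitive) :
    (prodChar ψ ψ').IsPrimitive := by
  rintro ⟨a, b⟩ hab h
  have h' : ∀ x y, ψ (a * x) * ψ' (b * y) = 1 := fun x y =>
    congrArg (fun χ : AddChar (K × K') ℂˣ => χ (x, y)) h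
  have ha : a = 0 := by
    by_contra ha
    exact hψ ha (by ext x; simpa using congrArg Units.val (h' x 0))
  have hb : b = 0 := by
    by_contra hb
    exact hψ' hb (by ext x; simpa using congrArg Units.val (h' 0 x))
  exact hab (by rw [ha, hb]; rfl)

theorem tensor_weyl (v : K × K) (w : K' × K') :
    tensor (weyl ψ v) (weyl ψ' w) = weyl (prodChar ψ ψ') ((v.1, w.1), (v.2, w.2)) := by
  apply Units.ext
  ext ⟨i, i'⟩ ⟨j, j'⟩
  change (weyl ψ v : Matrix K K ℂ) i j * (weyl ψ' w : Matrix K' K' ℂ) i' j' = _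
  simp only [weyl_apply, Prod.mk_add_mk, Prod.mk.injEq, Prod.mk_mul_mk, prodChar_apply]
  split_ifs <;> simp_all

theorem Ad_tensor_weyl (v : K × K) (w : K' × K') :
    Ad (tensor (weyl ψ v) (weyl ψ' w)) = phi (prodChar ψ ψ') ((v.1, w.1), (v.2, w.2)) := by
  rw [tensor_weyl]
  rfl

theorem conj_tensor {A : GL K ℂ} {B : GL K' ℂ} {v v' : K × K} {w w' : K' × K'}
    (hA : Ad A * phi ψ v * (Ad A)⁻¹ = phi ψ v') (hB : Ad B * phi ψ' w * (Ad B)⁻¹ = phi ψ' w') :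
    Ad (tensor A B) * phi (prodChar ψ ψ') ((v.1, w.1), (v.2, w.2)) * (Ad (tensor A B))⁻¹ =
      phi (prodChar ψ ψ') ((v'.1, w'.1), (v'.2, w'.2)) := by
  rw [← Ad_tensor_weyl, ← Ad_tensor_weyl, Ad_mul_apply, tensor_inv, tensor_mul, tensor_mul]
  rw [phi, phi, Ad_mul_apply] at hA hB
  exact Ad_tensor_congr hA hB

end Tensor

/-! ### The Weyl group of ℤ_n × ℤ_m and the action of R. -/

section Pair

variable (n m : ℕ) [NeZero n] [NeZero m]

/-- The additive character of `ZMod n × ZMod m` given by the two standard characters. -/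
abbrev pairChar : AddChar (ZMod n × ZMod m) ℂˣ := prodChar (pauliChar n) (pauliChar m)

theorem pairChar_primitive : (pairChar n m).IsPrimitive :=
  prodChar_primitive (pauliChar_primitive n) (pauliChar_primitive m)

theorem pauliTensor_eq_weylGroup : pauliTensor n m = weylGroup (pairChar n m) := by
  ext x
  rw [mem_weylGroup]
  constructor
  · rintro ⟨A, hA, B, hB, rfl⟩
    have hA' := Subgroup.mem_map_of_mem Ad hA
    have hB' := Subgroup.mem_map_of_mem Ad hB
    rw [map_heisenberg, pauliGroup_eq_weylGroup, mem_weylGroup] at hA' hB'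
    obtain ⟨v, hv⟩ := hA'
    obtain ⟨w, hw⟩ := hB'
    exact ⟨_, by rw [← Ad_tensor_weyl]; exact Ad_tensor_congr hv hw⟩
  · rintro ⟨⟨⟨p, p'⟩, ⟨l, l'⟩⟩, rfl⟩
    have hA := phi_mem (pauliChar n) (p, l)
    have hB := phi_mem (pauliChar m) (p', l')
    rw [← pauliGroup_eq_weylGroup, ← map_heisenberg] at hA hB
    obtain ⟨A, hA, hA'⟩ := hA
    obtain ⟨B, hB, hB'⟩ := hB
    refine ⟨A, hA, B, hB, ?_⟩
    rw [Ad_tensor_congr hA' hB', Ad_tensor_weyl]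

theorem mem_normPauliTensor {x : IntGL (ZMod n × ZMod m)} : x ∈ normPauliTensor n m ↔
    ∀ v, ∃ w, x * phi (pairChar n m) v * x⁻¹ = phi (pairChar n m) w := by
  rw [normPauliTensor, pauliTensor_eq_weylGroup]
  exact mem_normalizer_weylGroup _

theorem mem_normPauliTensor_of_mem_normTensorNorm {x : IntGL (ZMod n × ZMod m)}
    (hx : x ∈ normTensorNorm n m) : x ∈ normPauliTensor n m := by
  obtain ⟨A, B, hA, hB, rfl⟩ := hx
  refine (mem_normPauliTensor n m).2 fun u => ?_
  obtain ⟨v, hv⟩ := (mem_normPauli n).1 hA (u.1.1, u.2.1)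
  obtain ⟨w, hw⟩ := (mem_normPauli m).1 hB (u.1.2, u.2.2)
  have h := conj_tensor hv hw
  exact ⟨_, h⟩

theorem div_gcd_mul : m / Nat.gcd n m * n = n / Nat.gcd n m * m := by
  obtain ⟨a, ha⟩ := Nat.gcd_dvd_left n m
  obtain ⟨b, hb⟩ := Nat.gcd_dvd_right n m
  have hd : 0 < Nat.gcd n m := Nat.gcd_pos_of_pos_left m (NeZero.pos n)
  have ha' : n / Nat.gcd n m = a := Nat.div_eq_of_eq_mul_right hd ha
  have hb' : m / Nat.gcd n m = b := Nat.div_eq_of_eq_mul_right hd hb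
  rw [ha', hb']
  calc b * n = b * (Nat.gcd n m * a) := by rw [← ha]
    _ = a * (Nat.gcd n m * b) := by ring
    _ = a * m := by rw [← hb]

/-- Multiplication by `m / gcd(n,m)` as a map from `ZMod n` to `ZMod m`. -/
def scaleMap (x : ZMod n) : ZMod m := x.val * (m / Nat.gcd n m : ℕ)

/-- The value does not depend on the representative of z modulo n, as b·n = a·m vanishes modulo m.
-/
theorem scaleMap_intCast (z : ℤ) : scaleMap n m z = (z * (m / Nat.gcd n m : ℕ) : ℤ) := by
  rw [scaleMap, ← Int.cast_natCast (R := ZMod m) (ZMod.val _), ZMod.val_intCast]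
  have h : ((m / Nat.gcd n m : ℕ) : ZMod m) * (n : ZMod m) = 0 := by
    rw [← Nat.cast_mul, div_gcd_mul, Nat.cast_mul, ZMod.natCast_self, mul_zero]
  generalize m / Nat.gcd n m = b at h ⊢
  conv_rhs => rw [← Int.emod_add_mul_ediv z n]
  push_cast
  linear_combination -(((z / n : ℤ) : ZMod m)) * h

/-- Both ω_m^b and ω_n^a equal e^{2πi/d}, since b/m = a/n = 1/d. -/
theorem omega_zpow_div (z : ℤ) :
    omega m ^ ((m / Nat.gcd n m : ℕ) * z) = omega n ^ ((n / Nat.gcd n m : ℕ) * z) := by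
  rw [zpow_mul, zpow_mul]
  congr 1
  apply Units.ext
  have hn : (n : ℂ) ≠ 0 := Nat.cast_ne_zero.2 (NeZero.ne n)
  have hm : (m : ℂ) ≠ 0 := Nat.cast_ne_zero.2 (NeZero.ne m)
  simp only [Units.val_zpow_eq_zpow_val, omega, Units.val_mk0, ← Complex.exp_int_mul]
  congr 1
  have h : ((m / Nat.gcd n m : ℕ) : ℂ) * n = (n / Nat.gcd n m : ℕ) * m := by
    exact_mod_cast div_gcd_mul n m
  generalize m / Nat.gcd n m = b at h ⊢
  generalize n / Nat.gcd n m = a at h ⊢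
  push_cast
  field_simp
  linear_combination h

/-- The diagonal of R is the bicharacter ω_m^{b·i·i'} of ℤ_n × ℤ_m, hence a quadratic phase to which
`conj_diagGL` applies. -/
theorem matR_eq_diagGL :
    matR n m = diagGL fun i : ZMod n × ZMod m => pauliChar m (scaleMap n m i.1 * i.2) := by
  apply Units.ext
  ext ⟨i, i'⟩ ⟨j, j'⟩
  rw [diagGL_val, Matrix.diagonal_apply]
  change (if i = j then ((pauliQ m ^ (i.val * (m / Nat.gcd n m)) : GL (ZMod m) ℂ) :
    Matrix (ZMod m) (ZMod m) ℂ) i' j' else 0) = _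
  have h : pauliQ m ^ (i.val * (m / Nat.gcd n m)) =
      diagGL fun i' => pauliChar m (scaleMap n m i * i') := by
    rw [pauliQ, diagGL_pow]
    congr 1
    funext i'
    rw [← pauliChar_apply, ← AddChar.map_nsmul_eq_pow, nsmul_eq_mul, scaleMap, Nat.cast_mul]
  rw [h, diagGL_val, Matrix.diagonal_apply]
  by_cases h1 : i = j <;> by_cases h2 : i' = j' <;> simp [h1, h2]

theorem conj_matR (x y x' y' : ℤ) :
    Ad (matR n m) * phi (pairChar n m) ((x, x'), (y, y')) * (Ad (matR n m))⁻¹ =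
      phi (pairChar n m) (((x - (n / Nat.gcd n m : ℕ) * y' : ℤ),
        (x' - (m / Nat.gcd n m : ℕ) * y : ℤ)), (y, y')) := by
  have hg : (m / Nat.gcd n m : ℕ) = m / Nat.gcd m n := by rw [Nat.gcd_comm]
  rw [matR_eq_diagGL]
  refine (conj_diagGL (ψ := pairChar n m) _
    (fun l => pauliChar m (-(scaleMap n m l.1 * l.2)))
    (fun l => (-scaleMap m n l.2, -scaleMap n m l.1)) ?_ _).trans ?_
  · rintro ⟨i, i'⟩ ⟨l, l'⟩
    obtain ⟨i, rfl⟩ := ZMod.intCast_surjective i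
    obtain ⟨i', rfl⟩ := ZMod.intCast_surjective i'
    obtain ⟨l, rfl⟩ := ZMod.intCast_surjective l
    obtain ⟨l', rfl⟩ := ZMod.intCast_surjective l'
    simp only [prodChar_apply, Prod.mk_add_mk, Prod.mk_mul_mk, ← Int.cast_add, scaleMap_intCast,
      ← Int.cast_mul, ← Int.cast_neg, pauliChar_intCast, Nat.gcd_comm m n]
    -- Exposing the factor a allows the power of ω_n to be rewritten as one of ω_m; then only
    -- exponents remain to be compared.
    have e : -(l' * (n / Nat.gcd n m : ℕ)) * i = (n / Nat.gcd n m : ℕ) * (-l' * i) := by ring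
    rw [e, ← omega_zpow_div n m, ← zpow_add, ← zpow_add, ← zpow_add]
    congr 1
    push_cast
    ring
  · congr 1
    simp only [Prod.mk_add_mk, scaleMap_intCast, Nat.gcd_comm m n]
    push_cast
    ext <;> simp <;> ring

end Pair

/-! The group `𝒢` in terms of matrix entries. -/

section SymGroup

variable {n m d a b : ℕ}

theorem coe_eq_coe_iff (h : Admissible n m d a b) (A B : monoidS a b) :
    (A : (congrS h).Quotient) = B ↔ EquivS n m d A B := (congrS h).eq

theorem equivS_mkS (h : Admissible n m d a b) {A₁₁ A₁₂ A₂₁ A₂₂ B₁₁ B₁₂ B₂₁ B₂₂ : M2} :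
    EquivS n m d (mkS a b A₁₁ A₁₂ A₂₁ A₂₂) (mkS a b B₁₁ B₁₂ B₂₁ B₂₂) ↔
      MatModEq n A₁₁ B₁₁ ∧ MatModEq d A₁₂ B₁₂ ∧ MatModEq d A₂₁ B₂₁ ∧ MatModEq m A₂₂ B₂₂ := by
  simp only [EquivS, blk11_mkS, blk22_mkS, blk12_mkS b h.a_pos, blk21_mkS a h.b_pos]

/-- The symplectic pairing of the columns `i` of `X` and `j` of `Y`. -/
def colPair (X Y : M2) (i j : Fin 2) : ℤ := X 0 i * Y 1 j - X 1 i * Y 0 j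

theorem transpose_mul_J_mul (X Y : M2) (i j : Fin 2) :
    (X.transpose * matJ2 * Y) i j = colPair X Y i j := by
  fin_cases i <;> fin_cases j <;>
    simp [colPair, Matrix.mul_apply, Fin.sum_univ_two, matJ2] <;> ring

/-- The blocks of A*JA are built from XᵀJ₂Y. Antisymmetry leaves one condition in each diagonal
block, and the two off-diagonal blocks are negative transposes of each other, so one of them
suffices. -/
theorem mem_symGroup_iff (h : Admissible n m d a b) (A₁₁ A₁₂ A₂₁ A₂₂ : M2) :
    ((mkS a b A₁₁ A₁₂ A₂₁ A₂₂ : monoidS a b) : (congrS h).Quotient) ∈ symGroup h ↔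
      (colPair A₁₁ A₁₁ 0 1 + a * b * colPair A₂₁ A₂₁ 0 1 ≡ 1 [ZMOD n] ∧
        a * b * colPair A₁₂ A₁₂ 0 1 + colPair A₂₂ A₂₂ 0 1 ≡ 1 [ZMOD m]) ∧
      ∀ i j, colPair A₁₁ A₁₂ i j + colPair A₂₁ A₂₂ i j ≡ 0 [ZMOD d] := by
  have e : ((mkS a b A₁₁ A₁₂ A₂₁ A₂₂ : monoidS a b) : (congrS h).Quotient) ∈ symGroup h ↔
      EquivS n m d (starS (mkS a b A₁₁ A₁₂ A₂₁ A₂₂) * matJ a b * mkS a b A₁₁ A₁₂ A₂₁ A₂₂)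
        (matJ a b) :=
    coe_eq_coe_iff h _ _
  rw [e, starS_mkS h.a_pos h.b_pos, matJ, mkS_mul, mkS_mul, equivS_mkS h]
  simp only [Matrix.mul_zero, smul_zero, add_zero, zero_add, MatModEq, Matrix.add_apply,
    Matrix.smul_apply, transpose_mul_J_mul, smul_eq_mul, Matrix.zero_apply]
  have hself : ∀ X : M2, colPair X X 0 0 = 0 ∧ colPair X X 1 1 = 0 ∧
      colPair X X 1 0 = -colPair X X 0 1 := fun X => by
    simp only [colPair]
    refine ⟨?_, ?_, ?_⟩ <;> ring
  have hdiag : ∀ (X Y : M2) (c c' k : ℤ),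
      (∀ i j, c * colPair X X i j + c' * colPair Y Y i j ≡ matJ2 i j [ZMOD k]) ↔
        c * colPair X X 0 1 + c' * colPair Y Y 0 1 ≡ 1 [ZMOD k] := by
    intro X Y c c' k
    constructor
    · intro h; exact h 0 1
    · intro h i j
      fin_cases i <;> fin_cases j
      · simp [hself, matJ2, Int.ModEq.refl]
      · exact h
      · have := h.neg
        simp only [Fin.mk_one, Fin.zero_eta, (hself _).2.2]
        rw [neg_add] at this
        simpa [matJ2] using this
      · simp [hself, matJ2, Int.ModEq.refl]
  have hd1 := hdiag A₁₁ A₂₁ 1 (a * b) n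
  have hd2 := hdiag A₁₂ A₂₂ (a * b) 1 m
  simp only [one_mul] at hd1 hd2
  rw [hd1, hd2]
  have hoff : ∀ i j, colPair A₁₂ A₁₁ i j + colPair A₂₂ A₂₁ i j =
      -(colPair A₁₁ A₁₂ j i + colPair A₂₁ A₂₂ j i) := fun i j => by
    simp only [colPair]; ring
  simp only [hoff]
  constructor
  · rintro ⟨h1, h2, -, h4⟩
    exact ⟨⟨h1, h4⟩, h2⟩
  · rintro ⟨⟨h1, h4⟩, h2⟩
    exact ⟨h1, h2, fun i j => by simpa using (h2 j i).neg, h4⟩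

theorem finite_quotient (h : Admissible n m d a b) : Finite (congrS h).Quotient := by
  have : NeZero n := ⟨h.n_pos.ne'⟩
  have : NeZero m := ⟨h.m_pos.ne'⟩
  have : NeZero d := ⟨h.d_pos.ne'⟩
  let red (k : ℕ) (A : M2) : Matrix (Fin 2) (Fin 2) (ZMod k) := A.map (Int.cast : ℤ → ZMod k)
  have hred : ∀ (k : ℕ) (A B : M2), red k A = red k B ↔ MatModEq k A B := by
    intro k A B
    simp only [red, ← Matrix.ext_iff, Matrix.map_apply, MatModEq, ZMod.intCast_eq_intCast_iff]
  let f : monoidS a b → Matrix (Fin 2) (Fin 2) (ZMod n) × Matrix (Fin 2) (Fin 2) (ZMod d) ×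
      Matrix (Fin 2) (Fin 2) (ZMod d) × Matrix (Fin 2) (Fin 2) (ZMod m) :=
    fun A => (red n (blk11 A), red d (blk12 A), red d (blk21 A), red m (blk22 A))
  have hf : ∀ A B, f A = f B ↔ EquivS n m d A B := by
    intro A B
    simp only [f, Prod.mk.injEq, hred, EquivS]
  refine Finite.of_injective
    (Quotient.lift f fun A B hAB => (hf A B).2 hAB : (congrS h).Quotient → _) ?_
  intro x y hxy
  induction x using Con.induction_on with | _ A
  induction y using Con.induction_on with | _ B
  exact (coe_eq_coe_iff h A B).2 ((hf A B).1 hxy)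

end SymGroup

/-! The action of integral matrices on the phase space. -/

section Realizes

variable (n m : ℕ)

/-- Reduction of an integral vector to the phase space of `ZMod n × ZMod m`. -/
def castPhase : (Fin 2 ⊕ Fin 2 → ℤ) →+ (ZMod n × ZMod m) × (ZMod n × ZMod m) where
  toFun v :=
    (((v (.inl 0) : ZMod n), (v (.inr 0) : ZMod m)), ((v (.inl 1) : ZMod n), (v (.inr 1) : ZMod m)))
  map_zero' := by simp
  map_add' v w := by simp

theorem castPhase_apply (v : Fin 2 ⊕ Fin 2 → ℤ) :
    castPhase n m v =
      (((v (.inl 0) : ZMod n), (v (.inr 0) : ZMod m)), ((v (.inl 1) : ZMod n), (v (.inr 1) : ZMod m))) := rfl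

theorem castPhase_surjective : Function.Surjective (castPhase n m) := by
  rintro ⟨⟨x, x'⟩, ⟨y, y'⟩⟩
  obtain ⟨x, rfl⟩ := ZMod.intCast_surjective x
  obtain ⟨x', rfl⟩ := ZMod.intCast_surjective x'
  obtain ⟨y, rfl⟩ := ZMod.intCast_surjective y
  obtain ⟨y', rfl⟩ := ZMod.intCast_surjective y'
  exact ⟨Sum.elim ![x, y] ![x', y'], by simp [castPhase_apply]⟩

theorem castPhase_eq_iff (v w : Fin 2 ⊕ Fin 2 → ℤ) :
    castPhase n m v = castPhase n m w ↔
      (∀ i, v (.inl i) ≡ w (.inl i) [ZMOD n]) ∧ ∀ i, v (.inr i) ≡ w (.inr i) [ZMOD m] := by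
  simp only [castPhase_apply, Prod.mk.injEq, ZMod.intCast_eq_intCast_iff, Fin.forall_fin_two]
  tauto

theorem mkS_mulVec_inl (a b : ℕ) (A₁₁ A₁₂ A₂₁ A₂₂ : M2) (v : Fin 2 ⊕ Fin 2 → ℤ) (i : Fin 2) :
    ((mkS a b A₁₁ A₁₂ A₂₁ A₂₂).1.mulVec v) (.inl i) =
      A₁₁ i 0 * v (.inl 0) + A₁₁ i 1 * v (.inl 1) +
        a * (A₁₂ i 0 * v (.inr 0) + A₁₂ i 1 * v (.inr 1)) := by
  simp only [mkS, blockMat, Matrix.mulVec, dotProduct, Fintype.sum_sum_type, Fin.sum_univ_two,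
    Matrix.fromBlocks_apply₁₁, Matrix.fromBlocks_apply₁₂, Matrix.smul_apply, smul_eq_mul]
  ring

theorem mkS_mulVec_inr (a b : ℕ) (A₁₁ A₁₂ A₂₁ A₂₂ : M2) (v : Fin 2 ⊕ Fin 2 → ℤ) (i : Fin 2) :
    ((mkS a b A₁₁ A₁₂ A₂₁ A₂₂).1.mulVec v) (.inr i) =
      b * (A₂₁ i 0 * v (.inl 0) + A₂₁ i 1 * v (.inl 1)) +
        (A₂₂ i 0 * v (.inr 0) + A₂₂ i 1 * v (.inr 1)) := by
  simp only [mkS, blockMat, Matrix.mulVec, dotProduct, Fintype.sum_sum_type, Fin.sum_univ_two,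
    Matrix.fromBlocks_apply₂₁, Matrix.fromBlocks_apply₂₂, Matrix.smul_apply, smul_eq_mul]
  ring

variable {n m} {d a b : ℕ}

/-- Congruent matrices are those with the same action on the phase space. -/
theorem equivS_iff_castPhase (h : Admissible n m d a b) (hn : n = a * d) (hm : m = b * d)
    (A B : monoidS a b) :
    EquivS n m d A B ↔ ∀ v, castPhase n m (A.1.mulVec v) = castPhase n m (B.1.mulVec v) := by
  obtain ⟨A₁₁, A₁₂, A₂₁, A₂₂, rfl⟩ := exists_mkS A
  obtain ⟨B₁₁, B₁₂, B₂₁, B₂₂, rfl⟩ := exists_mkS B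
  rw [equivS_mkS h]
  simp only [castPhase_eq_iff, mkS_mulVec_inl, mkS_mulVec_inr]
  have ha : (a : ℤ) ≠ 0 := by exact_mod_cast h.a_pos.ne'
  have hb : (b : ℤ) ≠ 0 := by exact_mod_cast h.b_pos.ne'
  have hn' : (n : ℤ) = a * d := by exact_mod_cast hn
  have hm' : (m : ℤ) = b * d := by exact_mod_cast hm
  -- As n = ad and m = bd, the factors a and b in the off-diagonal blocks reduce the modulus to d.
  have hca : ∀ x y : ℤ, a * x ≡ a * y [ZMOD n] ↔ x ≡ y [ZMOD d] := fun x y => by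
    rw [hn', Int.modEq_iff_dvd, Int.modEq_iff_dvd, ← mul_sub, mul_dvd_mul_iff_left ha]
  have hcb : ∀ x y : ℤ, b * x ≡ b * y [ZMOD m] ↔ x ≡ y [ZMOD d] := fun x y => by
    rw [hm', Int.modEq_iff_dvd, Int.modEq_iff_dvd, ← mul_sub, mul_dvd_mul_iff_left hb]
  constructor
  · rintro ⟨h1, h2, h3, h4⟩ v
    refine ⟨fun i => ?_, fun i => ?_⟩
    · exact (((h1 i 0).mul_right _).add ((h1 i 1).mul_right _)).add
        ((hca _ _).2 (((h2 i 0).mul_right _).add ((h2 i 1).mul_right _)))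
    · exact ((hcb _ _).2 (((h3 i 0).mul_right _).add ((h3 i 1).mul_right _))).add
        (((h4 i 0).mul_right _).add ((h4 i 1).mul_right _))
  · intro H
    refine ⟨fun i j => ?_, fun i j => ?_, fun i j => ?_, fun i j => ?_⟩
    · have := (H (Sum.elim (Pi.single j 1) 0)).1 i
      fin_cases j <;> simpa using this
    · have := (H (Sum.elim 0 (Pi.single j 1))).1 i
      rw [← hca]
      fin_cases j <;> simpa using this
    · have := (H (Sum.elim (Pi.single j 1) 0)).2 i
      rw [← hcb]
      fin_cases j <;> simpa using this
    · have := (H (Sum.elim 0 (Pi.single j 1))).2 i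
      fin_cases j <;> simpa using this

variable [NeZero n] [NeZero m]

/-- The integral matrix `A` describes the action of the inner automorphism `x` by conjugation on
the Weyl operators. -/
def Realizes (x : IntGL (ZMod n × ZMod m)) (A : monoidS a b) : Prop :=
  ∀ v, x * phi (pairChar n m) (castPhase n m v) * x⁻¹ =
    phi (pairChar n m) (castPhase n m (A.1.mulVec v))

theorem Realizes.mul {x y : IntGL (ZMod n × ZMod m)} {A B : monoidS a b} (hx : Realizes x A)
    (hy : Realizes y B) : Realizes (x * y) (A * B) := by
  intro v
  have e : (A * B).1.mulVec v = A.1.mulVec (B.1.mulVec v) := by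
    rw [Matrix.mulVec_mulVec]; rfl
  rw [e, ← hx, ← hy]
  group

theorem Realizes.one : Realizes (1 : IntGL (ZMod n × ZMod m)) (1 : monoidS a b) := by
  intro v
  have e : (1 : monoidS a b).1.mulVec v = v := Matrix.one_mulVec v
  rw [e]
  group

/-- Cancellation of a realized left factor. -/
theorem Realizes.of_mul {x y : IntGL (ZMod n × ZMod m)} {A B : monoidS a b} (hx : Realizes x A)
    (hy : Realizes y (A * B)) : Realizes (x⁻¹ * y) B := by
  intro v
  have e : (A * B).1.mulVec v = A.1.mulVec (B.1.mulVec v) := by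
    rw [Matrix.mulVec_mulVec]; rfl
  have h := hy v
  rw [e, ← hx] at h
  calc x⁻¹ * y * phi (pairChar n m) (castPhase n m v) * (x⁻¹ * y)⁻¹
      = x⁻¹ * (y * phi (pairChar n m) (castPhase n m v) * y⁻¹) * x := by group
    _ = _ := by rw [h]; group

theorem Realizes.congr (h : Admissible n m d a b) (hn : n = a * d) (hm : m = b * d)
    {x : IntGL (ZMod n × ZMod m)} {A B : monoidS a b} (hx : Realizes x A)
    (hAB : EquivS n m d A B) : Realizes x B := by
  intro v
  rw [hx, (equivS_iff_castPhase h hn hm A B).1 hAB]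

theorem Realizes.unique (h : Admissible n m d a b) (hn : n = a * d) (hm : m = b * d)
    {x : IntGL (ZMod n × ZMod m)} {A B : monoidS a b} (hA : Realizes x A)
    (hB : Realizes x B) : EquivS n m d A B := by
  rw [equivS_iff_castPhase h hn hm]
  intro v
  exact phi_injective (pairChar_primitive n m) ((hA v).symm.trans (hB v))

theorem Realizes.mem_normPauliTensor {x : IntGL (ZMod n × ZMod m)} {A : monoidS a b}
    (hx : Realizes x A) : x ∈ normPauliTensor n m := by
  refine (FiniteHeisenberg.mem_normPauliTensor n m).2 fun v => ?_
  obtain ⟨v, rfl⟩ := castPhase_surjective n m v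
  exact ⟨_, hx v⟩

theorem realizes_one_iff {x : IntGL (ZMod n × ZMod m)} :
    Realizes x (1 : monoidS a b) ↔ x ∈ pauliTensor n m := by
  have e : ∀ v, (1 : monoidS a b).1.mulVec v = v := fun v => Matrix.one_mulVec v
  rw [pauliTensor_eq_weylGroup]
  constructor
  · intro hx
    refine mem_weylGroup_of_commute (pairChar_primitive n m) fun v => ?_
    obtain ⟨v, rfl⟩ := castPhase_surjective n m v
    rw [hx v, e]
  · intro hx v
    obtain ⟨u, rfl⟩ := (mem_weylGroup _).1 hx
    rw [e, mul_inv_eq_iff_eq_mul, ← phi_add, ← phi_add, add_comm]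

/-- The columns of A are integral lifts of the images of the basis vectors under the induced
additive map. The factors a and b that membership in 𝒮 demands come from the orders of these
vectors. -/
theorem exists_realizes (hab : IsCoprime (a : ℤ) b) (hn : n = a * d) (hm : m = b * d)
    {x : IntGL (ZMod n × ZMod m)} (hx : x ∈ normPauliTensor n m) :
    ∃ A : monoidS a b, Realizes x A := by
  have hinj := phi_injective (pairChar_primitive n m)
  choose τ hτ using (FiniteHeisenberg.mem_normPauliTensor n m).1 hx
  let T : (ZMod n × ZMod m) × (ZMod n × ZMod m) →+ (ZMod n × ZMod m) × (ZMod n × ZMod m) :=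
    { toFun := τ
      map_zero' := hinj (by rw [← hτ, phi_zero]; group)
      map_add' v w := hinj (by rw [← hτ, phi_add, phi_add, ← hτ, ← hτ]; group) }
  have hd : (d : ℤ) ≠ 0 := by
    rintro h
    have : d = 0 := by exact_mod_cast h
    exact NeZero.ne n (by rw [hn, this, mul_zero])
  have hn' : (n : ℤ) = a * d := by exact_mod_cast hn
  have hm' : (m : ℤ) = b * d := by exact_mod_cast hm
  have hc : ∀ v, ∃ c, castPhase n m c = T (castPhase n m v) := fun v => castPhase_surjective n m _
  choose c hc using hc
  have horder : ∀ (k : ℕ) v, castPhase n m (k • v) = castPhase n m 0 →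
      castPhase n m (k • c v) = castPhase n m 0 := by
    intro k v h
    rw [map_nsmul, hc, ← map_nsmul, ← map_nsmul, h, map_zero, map_zero]
  -- n kills a basis vector of the ℤ_n part, hence also its image: bd divides ad·y for each
  -- ℤ_m-component y, and b ∣ y as a and b are coprime.
  have hinl : ∀ j i, (b : ℤ) ∣ c (Sum.elim (Pi.single j 1) 0) (.inr i) := by
    intro j i
    have h1 : castPhase n m (n • (Sum.elim (Pi.single j 1) 0 : Fin 2 ⊕ Fin 2 → ℤ)) = castPhase n m 0 := by
      rw [castPhase_eq_iff]
      refine ⟨fun i => ?_, fun i => ?_⟩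
      · simp [Int.modEq_zero_iff_dvd]
      · simp [Int.ModEq.refl]
    have h3 := ((castPhase_eq_iff n m _ _).1 (horder n _ h1)).2 i
    simp only [Pi.smul_apply, nsmul_eq_mul, Pi.zero_apply, Int.modEq_zero_iff_dvd] at h3
    rw [hn', hm', mul_right_comm, mul_dvd_mul_iff_right hd] at h3
    exact hab.symm.dvd_of_dvd_mul_left h3
  have hinr : ∀ j i, (a : ℤ) ∣ c (Sum.elim 0 (Pi.single j 1)) (.inl i) := by
    intro j i
    have h1 : castPhase n m (m • (Sum.elim 0 (Pi.single j 1) : Fin 2 ⊕ Fin 2 → ℤ)) = castPhase n m 0 := by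
      rw [castPhase_eq_iff]
      refine ⟨fun i => ?_, fun i => ?_⟩
      · simp [Int.ModEq.refl]
      · simp [Int.modEq_zero_iff_dvd]
    have h3 := ((castPhase_eq_iff n m _ _).1 (horder m _ h1)).1 i
    simp only [Pi.smul_apply, nsmul_eq_mul, Pi.zero_apply, Int.modEq_zero_iff_dvd] at h3
    rw [hn', hm', mul_right_comm, mul_dvd_mul_iff_right hd] at h3
    exact hab.dvd_of_dvd_mul_left h3
  choose p hp using hinl
  choose q hq using hinr
  let A : monoidS a b := mkS a b (Matrix.of fun i j => c (Sum.elim (Pi.single j 1) 0) (.inl i))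
    (Matrix.of fun i j => q j i) (Matrix.of fun i j => p j i)
    (Matrix.of fun i j => c (Sum.elim 0 (Pi.single j 1)) (.inr i))
  refine ⟨A, ?_⟩
  have hA₁ : ∀ j, A.1.mulVec (Sum.elim (Pi.single j 1) 0) = c (Sum.elim (Pi.single j 1) 0) := by
    intro j
    funext i
    rcases i with i | i
    · rw [mkS_mulVec_inl]; fin_cases j <;> simp
    · rw [mkS_mulVec_inr, hp]; fin_cases j <;> simp
  have hA₂ : ∀ j, A.1.mulVec (Sum.elim 0 (Pi.single j 1)) = c (Sum.elim 0 (Pi.single j 1)) := by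
    intro j
    funext i
    rcases i with i | i
    · rw [mkS_mulVec_inl, hq]; fin_cases j <;> simp
    · rw [mkS_mulVec_inr]; fin_cases j <;> simp
  have key : T.comp (castPhase n m) =
      (castPhase n m).comp (Matrix.mulVecLin A.1).toAddMonoidHom := by
    refine AddMonoidHom.functions_ext _ _ _ fun j x => ?_
    have e : (Pi.single j x : Fin 2 ⊕ Fin 2 → ℤ) = x • Pi.single j 1 := by
      rw [← Pi.single_smul, smul_eq_mul, mul_one]
    rw [e, map_zsmul, map_zsmul]
    congr 1
    change T (castPhase n m _) = castPhase n m (A.1.mulVec _)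
    rw [← hc]
    rcases j with j | j
    · rw [← Sum.elim_single_zero, hA₁]
    · rw [← Sum.elim_zero_single, hA₂]
  intro v
  rw [hτ]
  exact congrArg (phi _) (DFunLike.congr_fun key v)

/-- Over the common denominator abd, ω_n^x ω_m^y = exp(2πi(bx + ay)/(abd)). -/
theorem pairChar_intCast_eq_one_iff (hn : n = a * d) (hm : m = b * d) (x y : ℤ) :
    pairChar n m (x, y) = 1 ↔ (a * b * d : ℤ) ∣ b * x + a * y := by
  have hn0 : (n : ℂ) ≠ 0 := Nat.cast_ne_zero.2 (NeZero.ne n)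
  have hm0 : (m : ℂ) ≠ 0 := Nat.cast_ne_zero.2 (NeZero.ne m)
  have hn' : (n : ℂ) = a * d := by exact_mod_cast hn
  have hm' : (m : ℂ) = b * d := by exact_mod_cast hm
  rw [hn'] at hn0
  rw [hm'] at hm0
  have ha := left_ne_zero_of_mul hn0
  have hb := left_ne_zero_of_mul hm0
  have hd := right_ne_zero_of_mul hn0
  have hpi : (2 * Real.pi * Complex.I : ℂ) ≠ 0 := Complex.two_pi_I_ne_zero
  rw [prodChar_apply, pauliChar_intCast, pauliChar_intCast, Units.ext_iff, Units.val_mul,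
    Units.val_zpow_eq_zpow_val, Units.val_zpow_eq_zpow_val, omega, omega, Units.val_mk0,
    Units.val_mk0, ← Complex.exp_int_mul, ← Complex.exp_int_mul, ← Complex.exp_add, Units.val_one,
    Complex.exp_eq_one_iff, dvd_def]
  refine exists_congr fun k => ?_
  have e : (x * (2 * Real.pi * Complex.I / n) + y * (2 * Real.pi * Complex.I / m) : ℂ) =
      (b * x + a * y) / (a * b * d) * (2 * Real.pi * Complex.I) := by
    rw [hn', hm']
    field_simp
  rw [e, mul_left_inj' hpi, div_eq_iff (mul_ne_zero (mul_ne_zero ha hb) hd), mul_comm (k : ℂ)]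
  exact_mod_cast Iff.rfl

/-- The matrix of an inner automorphism preserves the commutation form of the Weyl operators. -/
theorem Realizes.dvd (hn : n = a * d) (hm : m = b * d)
    {x : IntGL (ZMod n × ZMod m)} {A : monoidS a b} (hx : Realizes x A)
    (v w v' w' : Fin 2 ⊕ Fin 2 → ℤ) (hv : A.1.mulVec v = v') (hw : A.1.mulVec w = w') :
    (a * b * d : ℤ) ∣
      b * (v (.inl 0) * w (.inl 1) - v (.inl 1) * w (.inl 0) -
        (v' (.inl 0) * w' (.inl 1) - v' (.inl 1) * w' (.inl 0))) +
      a * (v (.inr 0) * w (.inr 1) - v (.inr 1) * w (.inr 0) -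
        (v' (.inr 0) * w' (.inr 1) - v' (.inr 1) * w' (.inr 0))) := by
  subst hv hw
  have h := symplectic_of_conj (hx w) (hx v)
  rw [← div_eq_one, ← AddChar.map_sub_eq_div] at h
  rw [← pairChar_intCast_eq_one_iff hn hm, ← h]
  congr 1
  simp only [castPhase_apply, Prod.mk_mul_mk, Prod.mk_sub_mk]
  push_cast
  ext <;> simp <;> ring

/-- Evaluate `Realizes.dvd`, a divisibility by abd, on pairs of basis vectors. Two vectors of the
first block give a common factor b and so a congruence modulo ad = n; two of the second give a
factor a and modulus m; a mixed pair gives ab and modulus d. -/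
theorem Realizes.mem_symGroup (h : Admissible n m d a b) (hn : n = a * d) (hm : m = b * d)
    {x : IntGL (ZMod n × ZMod m)} {A : monoidS a b} (hx : Realizes x A) :
    (A : (congrS h).Quotient) ∈ symGroup h := by
  have ha : (a : ℤ) ≠ 0 := by exact_mod_cast h.a_pos.ne'
  have hb : (b : ℤ) ≠ 0 := by exact_mod_cast h.b_pos.ne'
  have hn' : (n : ℤ) = a * d := by exact_mod_cast hn
  have hm' : (m : ℤ) = b * d := by exact_mod_cast hm
  obtain ⟨A₁₁, A₁₂, A₂₁, A₂₂, rfl⟩ := exists_mkS A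
  rw [mem_symGroup_iff]
  have H := fun v w => hx.dvd hn hm v w _ _ rfl rfl
  simp only [mkS_mulVec_inl, mkS_mulVec_inr] at H
  refine ⟨⟨?_, ?_⟩, fun i j => ?_⟩
  · have := H (Sum.elim ![1, 0] 0) (Sum.elim ![0, 1] 0)
    simp only [Sum.elim_inl, Sum.elim_inr, Matrix.cons_val_zero, Matrix.cons_val_one,
      Pi.zero_apply] at this
    rw [Int.modEq_iff_dvd, hn', ← mul_dvd_mul_iff_left hb]
    simp only [colPair]
    obtain ⟨k, hk⟩ := this
    exact ⟨k, by linear_combination hk⟩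
  · have := H (Sum.elim 0 ![1, 0]) (Sum.elim 0 ![0, 1])
    simp only [Sum.elim_inl, Sum.elim_inr, Matrix.cons_val_zero, Matrix.cons_val_one,
      Pi.zero_apply] at this
    rw [Int.modEq_iff_dvd, hm', ← mul_dvd_mul_iff_left ha]
    simp only [colPair]
    obtain ⟨k, hk⟩ := this
    exact ⟨k, by linear_combination hk⟩
  · have := H (Sum.elim (Pi.single i 1) 0) (Sum.elim 0 (Pi.single j 1))
    rw [Int.modEq_iff_dvd, ← mul_dvd_mul_iff_left (mul_ne_zero ha hb)]
    simp only [colPair]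
    obtain ⟨k, hk⟩ := this
    refine ⟨k, ?_⟩
    fin_cases i <;> fin_cases j <;> simp at hk ⊢ <;> linear_combination hk

end Realizes

/-! Reduction of integral matrices by `SL(2, ℤ)`. -/

section SL2

open scoped MatrixGroups

/-- Stated so as to include x = y = 0, which spares the row reductions a case distinction. -/
theorem exists_eq_mul_coprime (x y : ℤ) :
    ∃ g x' y' α β : ℤ, x = g * x' ∧ y = g * y' ∧ α * x' + β * y' = 1 := by
  obtain ⟨x', y', hx, hy, hu⟩ := extract_gcd x y
  obtain ⟨α, β, h⟩ := ((gcd_isUnit_iff x' y').1 hu : IsCoprime x' y')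
  exact ⟨_, x', y', α, β, hx, hy, h⟩

theorem exists_SL2_snd_eq_zero (x y : ℤ) : ∃ s : SL(2, ℤ), s.1 1 0 * x + s.1 1 1 * y = 0 := by
  obtain ⟨g, x', y', α, β, rfl, rfl, h⟩ := exists_eq_mul_coprime x y
  refine ⟨⟨!![α, β; -y', x'], by rw [Matrix.det_fin_two_of]; linear_combination h⟩, ?_⟩
  simp
  ring

theorem exists_SL2_fst_eq_zero (x y : ℤ) : ∃ s : SL(2, ℤ), s.1 0 0 * x + s.1 0 1 * y = 0 := by
  obtain ⟨g, x', y', α, β, rfl, rfl, h⟩ := exists_eq_mul_coprime x y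
  refine ⟨⟨!![-y', x'; -α, -β], by rw [Matrix.det_fin_two_of]; linear_combination h⟩, ?_⟩
  simp
  ring

theorem colPair_SL2_mul (s : SL(2, ℤ)) (X Y : M2) (i j : Fin 2) :
    colPair (s.1 * X) (s.1 * Y) i j = colPair X Y i j := by
  have h := s.2
  rw [Matrix.det_fin_two] at h
  simp only [colPair, Matrix.mul_apply, Fin.sum_univ_two]
  linear_combination (X 0 i * Y 1 j - X 1 i * Y 0 j) * h

/-- A matrix of determinant one modulo `k` is invertible modulo `k` by an element of
`SL(2, ℤ)`. -/
theorem exists_SL2_mul_modEq_one (k : ℕ) (B : M2) (hB : colPair B B 0 1 ≡ 1 [ZMOD k]) :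
    ∃ s : SL(2, ℤ), MatModEq k (s.1 * B) 1 := by
  obtain ⟨s, hs⟩ := exists_SL2_fst_eq_zero (B 0 0) (B 1 0)
  rw [← colPair_SL2_mul s] at hB
  have h00 : (s.1 * B) 0 0 = 0 := by rw [Matrix.mul_apply, Fin.sum_univ_two, hs]
  generalize hC : s.1 * B = C at hB h00
  set g := C 1 0
  set p := C 0 1
  set q := C 1 1
  have hgp : -(g * p) ≡ 1 [ZMOD k] := by
    have e : colPair C C 0 1 = -(g * p) := by
      simp only [colPair, h00]
      change 0 * q - g * p = _
      ring
    rwa [e] at hB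
  -- Modulo k the matrix with rows (1, -p), (-g, 1 + gp), of determinant 1 over ℤ, takes C to the
  -- unipotent matrix with corner p - pq. Subtracting c times its second row from its first clears
  -- that corner.
  obtain ⟨c, hc⟩ : ∃ c, c = p - p * q := ⟨_, rfl⟩
  let t : SL(2, ℤ) := ⟨!![1 + c * g, -p - c * (1 + g * p); -g, 1 + g * p], by
    rw [Matrix.det_fin_two_of]; ring⟩
  refine ⟨t * s, ?_⟩
  rw [Matrix.SpecialLinearGroup.coe_mul, mul_assoc, hC]
  have e : C = !![0, p; g, q] := by
    ext i j
    fin_cases i <;> fin_cases j <;> first | exact h00 | rfl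
  obtain ⟨z, hz⟩ := hgp.symm.dvd
  have hz' : g * p = -1 - k * z := by linear_combination -hz
  rw [e]
  intro i j
  rw [Int.modEq_iff_dvd]
  fin_cases i <;> fin_cases j <;>
    simp only [t, Fin.mk_one, Fin.zero_eta, Matrix.mul_apply, Fin.sum_univ_two, Matrix.of_apply,
      Matrix.cons_val', Matrix.cons_val_zero, Matrix.cons_val_one, Matrix.cons_val_fin_one,
      Matrix.one_apply_eq, ne_eq, zero_ne_one, one_ne_zero, not_false_eq_true, Matrix.one_apply_ne]
  · refine ⟨z * (-1 - c * g), ?_⟩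
    linear_combination (1 + c * g) * hz'
  · refine ⟨z * (c - c * q), ?_⟩
    linear_combination (c * q - c) * hz' + hc
  · refine ⟨z * g, ?_⟩
    linear_combination (-g) * hz'
  · refine ⟨z * (q - 1), ?_⟩
    linear_combination (1 - q) * hz'

end SL2

/-! Generation of the symplectic group. -/

section Generation

open scoped MatrixGroups

variable {n m d a b : ℕ} [NeZero n] [NeZero m]

variable (n m) in
/-- The group generated by `𝒩(𝒫_n) ⊗ 𝒩(𝒫_m)` and `Ad_R`. -/
def genGroup : Subgroup (IntGL (ZMod n × ZMod m)) :=
  Subgroup.closure (normTensorNorm n m ∪ {Ad (matR n m)})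

/-- The action of `A` on the phase space is realized by an element of `genGroup`. -/
def Attained (n m : ℕ) [NeZero n] [NeZero m] (A : monoidS a b) : Prop :=
  ∃ x ∈ genGroup n m, Realizes x A

theorem Attained.mul {A B : monoidS a b} (hA : Attained n m A) (hB : Attained n m B) :
    Attained n m (A * B) := by
  obtain ⟨x, hx, hxA⟩ := hA
  obtain ⟨y, hy, hyB⟩ := hB
  exact ⟨x * y, mul_mem hx hy, hxA.mul hyB⟩

/-- This cancellation licenses the row reduction: B may be replaced by A * B for any attained A. -/
theorem Attained.of_mul {A B : monoidS a b} (hA : Attained n m A) (hAB : Attained n m (A * B)) :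
    Attained n m B := by
  obtain ⟨x, hx, hxA⟩ := hA
  obtain ⟨y, hy, hyB⟩ := hAB
  exact ⟨x⁻¹ * y, mul_mem (inv_mem hx) hy, hxA.of_mul hyB⟩

theorem Attained.one : Attained n m (1 : monoidS a b) := ⟨1, one_mem _, Realizes.one⟩

theorem attained_SL2 (s t : SL(2, ℤ)) : Attained n m (mkS a b s.1 0 0 t.1) := by
  obtain ⟨A, hA⟩ := exists_conj_SL2 n s
  obtain ⟨B, hB⟩ := exists_conj_SL2 m t
  refine ⟨Ad (tensor A B), Subgroup.subset_closure (Or.inl ⟨A, B, ?_, ?_, rfl⟩), fun v => ?_⟩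
  · exact (mem_normPauli n).2 fun v => ⟨_, hA v⟩
  · exact (mem_normPauli m).2 fun v => ⟨_, hB v⟩
  · have h := conj_tensor (hA (v (.inl 0), v (.inl 1))) (hB (v (.inr 0), v (.inr 1)))
    rw [castPhase_apply, castPhase_apply]
    refine h.trans ?_
    simp only [act2, mkS_mulVec_inl, mkS_mulVec_inr]
    push_cast
    simp

/-- The nilpotent matrix unit `E₀₁`. -/
def matE : M2 := !![0, 1; 0, 0]

theorem matE_mul (X : M2) : matE * X = !![X 1 0, X 1 1; 0, 0] := by
  ext i j
  fin_cases i <;> fin_cases j <;> simp [matE, Matrix.mul_apply, Fin.sum_univ_two]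

theorem matE_mul_self : matE * matE = 0 := by
  rw [matE_mul]
  ext i j
  fin_cases i <;> fin_cases j <;> simp [matE]

/-- The powers of the matrix describing the action of `R`. -/
def matT (a b : ℕ) (k : ℤ) : monoidS a b := mkS a b 1 (k • matE) (k • matE) 1

theorem matT_mul (k l : ℤ) : matT a b k * matT a b l = matT a b (k + l) := by
  simp only [matT, mkS_mul, Matrix.smul_mul, Matrix.mul_smul, matE_mul_self, smul_zero, add_zero,
    zero_add, one_mul, mul_one, ← add_smul, add_comm l k]

theorem mkS_diag_mul (s t A₁₁ A₁₂ A₂₁ A₂₂ : M2) :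
    mkS a b s 0 0 t * mkS a b A₁₁ A₁₂ A₂₁ A₂₂ =
      mkS a b (s * A₁₁) (s * A₁₂) (t * A₂₁) (t * A₂₂) := by
  simp only [mkS_mul, Matrix.zero_mul, smul_zero, add_zero, zero_add]

theorem matT_mul_mkS (k : ℤ) (A₁₁ A₁₂ A₂₁ A₂₂ : M2) :
    matT a b k * mkS a b A₁₁ A₁₂ A₂₁ A₂₂ =
      mkS a b (A₁₁ + ((a : ℤ) * b) • k • (matE * A₂₁)) (A₁₂ + k • (matE * A₂₂))
        (k • (matE * A₁₁) + A₂₁) (((a : ℤ) * b) • k • (matE * A₁₂) + A₂₂) := by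
  simp only [matT, mkS_mul, one_mul, Matrix.smul_mul]

theorem matT_zero : matT a b 0 = 1 := by
  rw [matT, zero_smul]
  exact Subtype.ext (blockMat_one a b)

theorem attained_matT (hR : Realizes (Ad (matR n m)) (matT a b (-1))) (k : ℤ) :
    Attained n m (matT a b k) := by
  have h1 : Attained n m (matT a b (-1)) :=
    ⟨_, Subgroup.subset_closure (Or.inr rfl), hR⟩
  induction k using Int.induction_on with
  | zero => rw [matT_zero]; exact Attained.one
  | succ k ih => exact h1.of_mul (by rwa [matT_mul, neg_add_cancel_comm_assoc])
  | pred k ih =>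
    have := h1.mul ih
    rwa [matT_mul, add_comm, ← sub_eq_add_neg] at this

theorem realizes_matR (n m : ℕ) [NeZero n] [NeZero m] :
    Realizes (Ad (matR n m)) (matT (n / Nat.gcd n m) (m / Nat.gcd n m) (-1)) := by
  intro v
  rw [castPhase_apply, castPhase_apply, conj_matR]
  simp only [matT, mkS_mulVec_inl, mkS_mulVec_inr]
  congr 1
  simp [matE, sub_eq_add_neg]
  exact add_comm _ _

variable (h : Admissible n m d a b) (hn : n = a * d) (hm : m = b * d)
include h hn hm

theorem Attained.congr {A B : monoidS a b} (hB : Attained n m B) (hAB : EquivS n m d A B) :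
    Attained n m A := by
  obtain ⟨x, hx, hxB⟩ := hB
  exact ⟨x, hx, hxB.congr h hn hm ((congrS h).symm hAB)⟩

/-- Keeps the symplectic conditions available after each reduction step: attained matrices are
themselves in 𝒢. -/
theorem Attained.mul_mem_symGroup {A B : monoidS a b} (hA : Attained n m A)
    (hB : (B : (congrS h).Quotient) ∈ symGroup h) :
    ((A * B : monoidS a b) : (congrS h).Quotient) ∈ symGroup h := by
  obtain ⟨x, hx, hxA⟩ := hA
  exact mul_mem (hxA.mem_symGroup h hn hm) hB

omit hn hm [NeZero n] [NeZero m] in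
theorem mem_symGroup_congr {A B : monoidS a b} (hA : (A : (congrS h).Quotient) ∈ symGroup h)
    (hAB : EquivS n m d A B) : (B : (congrS h).Quotient) ∈ symGroup h := by
  rwa [← (coe_eq_coe_iff h A B).2 hAB]

variable (hR : Realizes (Ad (matR n m)) (matT a b (-1)))

omit hR in
-- Last stage of the elimination. Orthogonality to the columns of the identity block forces A₁₂ ≡ 0
-- modulo d; then A₂₂ has determinant 1 modulo m and is inverted by SL(2,ℤ).
theorem attained_of_diag {A₁₂ A₂₂ : M2}
    (hA : ((mkS a b 1 A₁₂ 0 A₂₂ : monoidS a b) : (congrS h).Quotient) ∈ symGroup h) :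
    Attained n m (mkS a b 1 A₁₂ 0 A₂₂) := by
  have hA₁₂ : MatModEq d A₁₂ 0 := by
    have h2 := ((mem_symGroup_iff h _ _ _ _).1 hA).2
    intro i j
    have h0 := h2 0 j
    have h1 := (h2 1 j).neg
    simp only [colPair, Matrix.zero_apply, Matrix.one_apply, zero_mul, sub_self, add_zero]
      at h0 h1
    fin_cases i
    · simpa using h1
    · simpa using h0
  have e : EquivS n m d (mkS a b 1 A₁₂ 0 A₂₂) (mkS a b 1 0 0 A₂₂) :=
    (equivS_mkS h).2 ⟨.refl _ _, hA₁₂, .refl _ _, .refl _ _⟩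
  refine Attained.congr h hn hm ?_ e
  have hA' := ((mem_symGroup_iff h _ _ _ _).1 (mem_symGroup_congr h hA e)).1.2
  obtain ⟨t, ht⟩ := exists_SL2_mul_modEq_one m A₂₂ (by simpa [colPair] using hA')
  refine (attained_SL2 1 t).of_mul (Attained.congr h hn hm Attained.one ?_)
  have e1 : (1 : monoidS a b) = mkS a b 1 0 0 1 := Subtype.ext (blockMat_one a b).symm
  rw [mkS_diag_mul, e1, equivS_mkS h, mul_zero, mul_zero, Matrix.SpecialLinearGroup.coe_one, one_mul]
  exact ⟨.refl _ _, .refl _ _, .refl _ _, ht⟩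

include hR

/-- With one column of A₂₁ zero, A₁₁ has determinant 1 modulo n and can be made the identity, while
A₂₁ is rotated to kE₀₁. The shear T^{-k} then clears A₂₁ and leaves the identity block alone, as
E₀₁² = 0. -/
theorem attained_of_col_eq_zero {A₁₁ A₁₂ A₂₁ A₂₂ : M2}
    (hA : ((mkS a b A₁₁ A₁₂ A₂₁ A₂₂ : monoidS a b) : (congrS h).Quotient) ∈ symGroup h)
    (h0 : A₂₁ 0 0 = 0) (h1 : A₂₁ 1 0 = 0) : Attained n m (mkS a b A₁₁ A₁₂ A₂₁ A₂₂) := by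
  have hdet := ((mem_symGroup_iff h _ _ _ _).1 hA).1.1
  obtain ⟨s, hs⟩ := exists_SL2_mul_modEq_one n A₁₁ (by
    simpa [colPair, h0, h1] using hdet)
  obtain ⟨t, ht⟩ := exists_SL2_snd_eq_zero (A₂₁ 0 1) (A₂₁ 1 1)
  have hst := attained_SL2 (n := n) (m := m) (a := a) (b := b) s t
  refine hst.of_mul ?_
  have hA' := hst.mul_mem_symGroup h hn hm hA
  rw [mkS_diag_mul] at hA' ⊢
  have hC : t.1 * A₂₁ = (t.1 * A₂₁) 0 1 • matE := by
    ext i j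
    fin_cases i <;> fin_cases j
    · simp [Matrix.mul_apply, Fin.sum_univ_two, h0, h1, matE]
    · simp [matE]
    · simp [Matrix.mul_apply, Fin.sum_univ_two, h0, h1, matE]
    · simpa [Matrix.mul_apply, Fin.sum_univ_two, matE] using ht
  generalize (t.1 * A₂₁) 0 1 = k at hC
  rw [hC] at hA' ⊢
  generalize s.1 * A₁₁ = B₁₁ at *
  generalize s.1 * A₁₂ = B₁₂ at *
  generalize t.1 * A₂₂ = B₂₂ at *
  have e : EquivS n m d (mkS a b B₁₁ B₁₂ (k • matE) B₂₂) (mkS a b 1 B₁₂ (k • matE) B₂₂) :=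
    (equivS_mkS h).2 ⟨hs, .refl _ _, .refl _ _, .refl _ _⟩
  refine Attained.congr h hn hm ?_ e
  have hA'' := mem_symGroup_congr h hA' e
  have hT := attained_matT hR (-k)
  refine hT.of_mul ?_
  have hA₃ := hT.mul_mem_symGroup h hn hm hA''
  rw [matT_mul_mkS, mul_one, Matrix.mul_smul, matE_mul_self, smul_zero, smul_zero, smul_zero,
    add_zero, ← add_smul, neg_add_cancel, zero_smul] at hA₃ ⊢
  exact attained_of_diag h hn hm hA₃

/-- Once the first column of A₁₁ is (0, 1), E₀₁A₁₁ has first column (1, 0). If that of A₂₁ has been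
rotated to (x, 0), then T^{-x} makes it zero. -/
theorem attained_of_col_modEq {A₁₁ A₁₂ A₂₁ A₂₂ : M2}
    (hA : ((mkS a b A₁₁ A₁₂ A₂₁ A₂₂ : monoidS a b) : (congrS h).Quotient) ∈ symGroup h)
    (h0 : A₁₁ 0 0 ≡ 0 [ZMOD n]) (h1 : A₁₁ 1 0 ≡ 1 [ZMOD n]) :
    Attained n m (mkS a b A₁₁ A₁₂ A₂₁ A₂₂) := by
  obtain ⟨t, ht⟩ := exists_SL2_snd_eq_zero (A₂₁ 0 0) (A₂₁ 1 0)
  have hst := attained_SL2 (n := n) (m := m) (a := a) (b := b) 1 t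
  refine hst.of_mul ?_
  have hA' := hst.mul_mem_symGroup h hn hm hA
  have e : EquivS n m d (mkS a b (1 : SL(2, ℤ)).1 0 0 t.1 * mkS a b A₁₁ A₁₂ A₂₁ A₂₂)
      (mkS a b !![0, A₁₁ 0 1; 1, A₁₁ 1 1] A₁₂ (t.1 * A₂₁) (t.1 * A₂₂)) := by
    rw [mkS_diag_mul, equivS_mkS h, Matrix.SpecialLinearGroup.coe_one, one_mul, one_mul]
    have h11 : MatModEq n A₁₁ !![0, A₁₁ 0 1; 1, A₁₁ 1 1] := by
      intro i j
      fin_cases i <;> fin_cases j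
      · exact h0
      · exact Int.ModEq.refl _
      · exact h1
      · exact Int.ModEq.refl _
    exact ⟨h11, .refl _ _, .refl _ _, .refl _ _⟩
  refine Attained.congr h hn hm ?_ e
  have hA'' := mem_symGroup_congr h hA' e
  have hT := attained_matT hR (-(t.1 * A₂₁) 0 0)
  refine hT.of_mul ?_
  have hA₃ := hT.mul_mem_symGroup h hn hm hA''
  rw [matT_mul_mkS] at hA₃ ⊢
  refine attained_of_col_eq_zero h hn hm hR hA₃ ?_ ?_
  · simp [matE, Matrix.mul_apply, Fin.sum_univ_two]
  · simpa [matE, Matrix.mul_apply, Fin.sum_univ_two] using ht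

/-- Every class in `𝒢` is attained. -/
theorem attained_of_mem_symGroup {A : monoidS a b}
    (hA : (A : (congrS h).Quotient) ∈ symGroup h) : Attained n m A := by
  obtain ⟨A₁₁, A₁₂, A₂₁, A₂₂, rfl⟩ := exists_mkS A
  obtain ⟨s, hs⟩ := exists_SL2_fst_eq_zero (A₁₁ 0 0) (A₁₁ 1 0)
  obtain ⟨t, ht⟩ := exists_SL2_fst_eq_zero (A₂₁ 0 0) (A₂₁ 1 0)
  have hst := attained_SL2 (n := n) (m := m) (a := a) (b := b) s t
  refine hst.of_mul ?_
  have hA' := hst.mul_mem_symGroup h hn hm hA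
  rw [mkS_diag_mul] at hA' ⊢
  have hs' : (s.1 * A₁₁) 0 0 = 0 := by rwa [Matrix.mul_apply, Fin.sum_univ_two]
  have ht' : (t.1 * A₂₁) 0 0 = 0 := by rwa [Matrix.mul_apply, Fin.sum_univ_two]
  generalize s.1 * A₁₁ = B₁₁ at *
  generalize s.1 * A₁₂ = B₁₂ at *
  generalize t.1 * A₂₁ = B₂₁ at *
  generalize t.1 * A₂₂ = B₂₂ at *
  have hdet := ((mem_symGroup_iff h _ _ _ _).1 hA').1.1
  -- With both top left entries zero, T changes the first column of B₁₁ to (ab·B₂₁ 1 0, B₁₁ 1 0).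
  -- The symplectic condition modulo n supplies a second column completing it to determinant 1, so u
  -- sends this column to (1, 0) modulo n.
  obtain ⟨u, hu⟩ := exists_SL2_mul_modEq_one n
    !![a * b * B₂₁ 1 0, B₁₁ 0 1; B₁₁ 1 0, -B₂₁ 0 1] (by
      convert hdet using 1
      simp [colPair, hs', ht']
      ring)
  have hT := attained_matT hR 1
  refine hT.of_mul ?_
  have hA₂ := hT.mul_mem_symGroup h hn hm hA'
  -- The extra factor S turns (1, 0) into (0, 1), the column required by `attained_of_col_modEq`.
  have hu' := attained_SL2 (n := n) (m := m) (a := a) (b := b) (ModularGroup.S * u) 1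
  refine hu'.of_mul ?_
  have hA₃ := hu'.mul_mem_symGroup h hn hm hA₂
  have hS : (ModularGroup.S * u).1 = !![-u.1 1 0, -u.1 1 1; u.1 0 0, u.1 0 1] := by
    rw [Matrix.SpecialLinearGroup.coe_mul, ModularGroup.coe_S]
    ext i j
    fin_cases i <;> fin_cases j <;> simp [Matrix.mul_apply, Fin.sum_univ_two]
  rw [matT_mul_mkS, mkS_diag_mul, hS] at hA₃ ⊢
  have hu0 := hu 0 0
  have hu1 := (hu 1 0).neg
  refine attained_of_col_modEq h hn hm hR hA₃ ?_ ?_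
  · simpa [matE_mul, hs', Matrix.mul_apply, Fin.sum_univ_two, add_comm] using hu1
  · simpa [matE_mul, hs', Matrix.mul_apply, Fin.sum_univ_two] using hu0

end Generation

/-! ### Generation of the normalizer and its quotient. -/

section Main

variable {n m d a b : ℕ} [NeZero n] [NeZero m]

theorem genGroup_eq_normPauliTensor (h : Admissible n m d a b) (hn : n = a * d) (hm : m = b * d)
    (hab : IsCoprime (a : ℤ) b) (hR : Realizes (Ad (matR n m)) (matT a b (-1))) :
    genGroup n m = normPauliTensor n m := by
  apply le_antisymm
  · rw [genGroup, Subgroup.closure_le]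
    rintro x (hx | rfl)
    · exact mem_normPauliTensor_of_mem_normTensorNorm n m hx
    · exact hR.mem_normPauliTensor
  · intro x hx
    obtain ⟨A, hA⟩ := exists_realizes hab hn hm hx
    obtain ⟨y, hy, hyA⟩ := attained_of_mem_symGroup h hn hm hR (hA.mem_symGroup h hn hm)
    have h1 : y⁻¹ * x ∈ pauliTensor n m := by
      rw [← realizes_one_iff (a := a) (b := b)]
      exact hyA.of_mul (by rwa [mul_one])
    -- 𝒫_n ⊗ 𝒫_m needs no further generators: each factor lies in its own normalizer.
    have h2 : y⁻¹ * x ∈ genGroup n m := by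
      obtain ⟨A, hA, B, hB, e⟩ := h1
      rw [e]
      have hA' := Subgroup.mem_map_of_mem Ad hA
      have hB' := Subgroup.mem_map_of_mem Ad hB
      rw [map_heisenberg] at hA' hB'
      exact Subgroup.subset_closure (Or.inl
        ⟨A, B, Subgroup.le_normalizer hA', Subgroup.le_normalizer hB', rfl⟩)
    simpa using mul_mem hy h2

theorem exists_mulEquiv_symGroup (h : Admissible n m d a b) (hn : n = a * d) (hm : m = b * d)
    (hab : IsCoprime (a : ℤ) b) (hR : Realizes (Ad (matR n m)) (matT a b (-1))) :
    Nonempty (normPauliTensor n m ⧸ (pauliTensor n m).subgroupOf (normPauliTensor n m) ≃*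
      symGroup h) := by
  choose A hA using fun x : normPauliTensor n m => exists_realizes hab hn hm x.2
  -- The integral matrix is an arbitrary choice, but its class is unique by `Realizes.unique`; this
  -- makes the map multiplicative.
  let f : normPauliTensor n m →* symGroup h :=
    { toFun x := ⟨_, (hA x).mem_symGroup h hn hm⟩
      map_one' := Subtype.ext ((coe_eq_coe_iff h _ 1).2 ((hA 1).unique h hn hm Realizes.one))
      map_mul' x y := Subtype.ext ((coe_eq_coe_iff h _ (A x * A y)).2
        ((hA (x * y)).unique h hn hm ((hA x).mul (hA y)))) }
  have hf : ∀ x, f x = 1 ↔ x ∈ (pauliTensor n m).subgroupOf (normPauliTensor n m) := by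
    intro x
    have e : f x = 1 ↔ EquivS n m d (A x) 1 :=
      Subtype.ext_iff.trans (coe_eq_coe_iff h (A x) 1)
    rw [e, Subgroup.mem_subgroupOf, ← realizes_one_iff (a := a) (b := b)]
    exact ⟨(hA x).congr h hn hm, (hA x).unique h hn hm⟩
  refine ⟨MulEquiv.ofBijective (QuotientGroup.lift _ f fun x hx => (hf x).2 hx) ⟨?_, ?_⟩⟩
  · rw [injective_iff_map_eq_one]
    intro q hq
    induction q using QuotientGroup.induction_on with | _ x
    exact (QuotientGroup.eq_one_iff x).2 ((hf x).1 hq)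
  · rintro ⟨q, hq⟩
    induction q using Con.induction_on with | _ B
    obtain ⟨x, hx, hxB⟩ := attained_of_mem_symGroup h hn hm hR hq
    let x' : normPauliTensor n m := ⟨x, hxB.mem_normPauliTensor⟩
    refine ⟨(x' : normPauliTensor n m ⧸ _), Subtype.ext ?_⟩
    exact (coe_eq_coe_iff h _ _).2 ((hA x').unique h hn hm hxB)

end Main

end

end FiniteHeisenberg

theorem theorem37 (n m : ℕ) [NeZero n] [NeZero m] :
    (Nonempty
        (FiniteHeisenberg.normPauliTensor n m ⧸
            (FiniteHeisenberg.pauliTensor n m).subgroupOf (FiniteHeisenberg.normPauliTensor n m) ≃*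
          FiniteHeisenberg.symGroup (FiniteHeisenberg.admissible_gcd n m)) ∧
      Finite (FiniteHeisenberg.symGroup (FiniteHeisenberg.admissible_gcd n m))) ∧
    Subgroup.closure
        (FiniteHeisenberg.normTensorNorm n m ∪
          {FiniteHeisenberg.Ad (FiniteHeisenberg.matR n m)}) =
      FiniteHeisenberg.normPauliTensor n m := by
  have hd : 0 < Nat.gcd n m := Nat.gcd_pos_of_pos_left m (NeZero.pos n)
  have hn : n = n / Nat.gcd n m * Nat.gcd n m := (Nat.div_mul_cancel (Nat.gcd_dvd_left n m)).symm
  have hm : m = m / Nat.gcd n m * Nat.gcd n m := (Nat.div_mul_cancel (Nat.gcd_dvd_right n m)).symm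
  have hab := Nat.isCoprime_iff_coprime.2 (Nat.coprime_div_gcd_div_gcd hd)
  have hR := FiniteHeisenberg.realizes_matR n m
  have h := FiniteHeisenberg.admissible_gcd n m
  have := FiniteHeisenberg.finite_quotient h
  exact ⟨⟨FiniteHeisenberg.exists_mulEquiv_symGroup h hn hm hab hR, inferInstance⟩,
    FiniteHeisenberg.genGroup_eq_normPauliTensor h hn hm hab hR⟩
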